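/- For a finite group $G$ let $D(G)$ be its Drinfel'd double over $\mathbb{C}$: the Hopf algebra with basis $e_g\otimes x$ ($g,x\in G$), product $(e_g\otimes x)(e_h\otimes y)=\delta_{g,xhx^{-1}}\,e_g\otimes xy$, coproduct $\Delta(e_g\otimes x)=\sum_{ab=g}(e_a\otimes x)\otimes(e_b\otimes x)$, counit $\varepsilon(e_g\otimes x)=\delta_{g,1}$, and normalized integral $\Lambda=|G|^{-1}\sum_{x\in G} e_1\otimes x$. For a finite-dimensional representation $V$ of $D(G)$ with character $\chi$ and $n\ge 1$, the $n$-th Frobenius-Schur indicator is $\nu_n(V)=\chi(\Lambda^{[n]})$, where $h^{[n]}=h_1h_2\cdots h_n$ in Sweedler notation. $G$ is $FSZ_n$ if $\nu_n(V)\in\mathbb{Z}$ for every irreducible $V$, and $FSZ$ if it is $FSZ_n$ for all $n\ge 1$. A $p$-group is regular if for all $a,b$ and every power $q$ of $p$ one has $(ab)^q=a^qb^qc_1^q\cdots c_t^q$ with all $c_i$ in the commutator subgroup of $\langle a,b\rangle$, and irregular otherwise. For $a,b,x,y,w\in\mathbb{Z}/5$ let $M(a,b,x,y,w)$ be the group with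 generators $s_0,\dots,s_5$ and relations $$s_0^5=s_5^a,\quad s_1^5=s_5^b,\quad s_2^5=s_3^5=s_4^5=s_5^5=1,\quad s_is_0=s_0s_is_{i+1}\ (1\le i\le 4),$$ $$s_2s_1=s_1s_2s_4^xs_5^y,\quad s_3s_1=s_1s_3s_5^{x+w},\quad s_4s_1=s_1s_4s_5^w,\quad s_3s_2=s_2s_3s_5^{-w},$$ $$s_4s_2=s_2s_4,\quad s_4s_3=s_3s_4,\quad s_5\ \text{central}.$$ 1. If $w\ne 0$, or if $b\neq 0$ and $(a,b)\ne(0,-1)$, then $M(a,b,x,y,w)$ is an irregular $5$-group of order $5^6=15625$ and exponent $25$, and some indicator $\nu_5(V)$ of an irreducible representation $V$ of $D(M(a,b,x,y,w))$ is not an integer. (Up to isomorphism these are the $32$ non-$FSZ$ groups of order $5^6$ of the GAP library, $\mathrm{SmallGroup}(15625,668)$ being one of them; this identification with library entries only explains the choice of the groups and is not part of the assertion.) 2. If $G$ is any group of order $5^6$ and exponent $25$ and $V$ is an irreducible representation of $D(G)$ for which $\nu_5(V)$ is not an integer, then $\nu_5(V)$ is an algebraic integer in $\mathbb{Q}(\sqrt5)\setminus\mathbb{Q}$.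 3. If a finite group $F$ is not $FSZ$, then $F\times H$ is not $FSZ$ for every finite group $H$. There are infinitely many non-$FSZ$ finite groups, up to isomorphism; indeed, infinitely many integers occur as orders of non-$FSZ$ groups. -/

import Mathlib

open scoped TensorProduct

universe u

/-! ### The quantum double of a finite group -/

/-- The quantum (Drinfel'd) double `D(G)` of a finite group `G` over `ℂ`, as a vector space with
basis the symbols `e_g ⊗ x`, `g, x ∈ G`. Here `e_g` is the indicator function of `g` in the
function algebra `ℂ^G`, and `x` is in the group algebra `ℂ G`. -/
def DrinfeldDouble (G : Type u) : Type u := G × G →₀ ℂ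

namespace DrinfeldDouble

noncomputable section

instance (G : Type u) : AddCommGroup (DrinfeldDouble G) :=
  inferInstanceAs (AddCommGroup (G × G →₀ ℂ))

instance (G : Type u) : Module ℂ (DrinfeldDouble G) :=
  inferInstanceAs (Module ℂ (G × G →₀ ℂ))

variable {G : Type u}

/-- The basis element `e_g ⊗ x` of `D(G)`. -/
def elt (g x : G) : DrinfeldDouble G := Finsupp.single (g, x) (1 : ℂ)

/-- The linear map out of `D(G)` with prescribed values on the basis elements `e_g ⊗ x`. -/
def lift {M : Type*} [AddCommGroup M] [Module ℂ M] (f : G → G → M) : DrinfeldDouble G →ₗ[ℂ] M :=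
  Finsupp.linearCombination ℂ (fun p : G × G => f p.1 p.2)

@[simp] theorem lift_elt {M : Type*} [AddCommGroup M] [Module ℂ M] (f : G → G → M) (g x : G) :
    lift f (elt g x) = f g x := by
  unfold lift elt
  exact (Finsupp.linearCombination_single ℂ (1 : ℂ) (g, x)).trans (one_smul ℂ _)

theorem induction {P : DrinfeldDouble G → Prop} (h : DrinfeldDouble G) (h0 : P 0)
    (hadd : ∀ a b, P a → P b → P (a + b)) (hs : ∀ (c : ℂ) g x, P (c • elt g x)) : P h := by
  refine Finsupp.induction_linear (motive := P) h h0 hadd ?_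
  rintro ⟨g, x⟩ c
  have := hs c g x
  unfold elt at this
  have e : c • (Finsupp.single (g, x) (1 : ℂ) : G × G →₀ ℂ) = Finsupp.single (g, x) c := by
    rw [Finsupp.smul_single, smul_eq_mul, mul_one]
  exact e ▸ this

theorem lin_ext {M : Type*} [AddCommGroup M] [Module ℂ M] {φ ψ : DrinfeldDouble G →ₗ[ℂ] M}
    (h : ∀ g x, φ (elt g x) = ψ (elt g x)) : φ = ψ := by
  ext a
  induction a using induction with
  | h0 => simp
  | hadd a b ha hb => rw [map_add, map_add, ha, hb]
  | hs c g x => rw [map_smul, map_smul, h]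

variable [Group G]

open Classical in
/-- The multiplication of `D(G)`:
`(e_g ⊗ x) (e_h ⊗ y) = e_g ⊗ x y` if `g = x h x⁻¹`, and `0` otherwise. -/
def mulHom : DrinfeldDouble G →ₗ[ℂ] DrinfeldDouble G →ₗ[ℂ] DrinfeldDouble G :=
  lift fun g x => lift fun h y => if g = x * h * x⁻¹ then elt g (x * y) else 0

instance : Mul (DrinfeldDouble G) := ⟨fun a b => mulHom a b⟩

theorem mul_def (a b : DrinfeldDouble G) : a * b = mulHom a b := rfl

open Classical in
theorem elt_mul_elt (g x h y : G) :
    elt g x * elt h y = if g = x * h * x⁻¹ then elt g (x * y) else 0 := by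
  rw [mul_def]; unfold mulHom; rw [lift_elt, lift_elt]

variable [Fintype G]

/-- The unit of `D(G)` is `∑_g e_g ⊗ 1`. -/
instance : One (DrinfeldDouble G) := ⟨∑ g : G, elt g 1⟩

theorem one_def : (1 : DrinfeldDouble G) = ∑ g : G, elt g 1 := rfl

instance : Ring (DrinfeldDouble G) :=
  { (inferInstance : AddCommGroup (DrinfeldDouble G)),
    (inferInstance : Mul (DrinfeldDouble G)),
    (inferInstance : One (DrinfeldDouble G)) with
    left_distrib := fun a b c => by simp only [mul_def, map_add]
    right_distrib := fun a b c => by simp only [mul_def, map_add, LinearMap.add_apply]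
    zero_mul := fun a => by simp only [mul_def, map_zero, LinearMap.zero_apply]
    mul_zero := fun a => by simp only [mul_def, map_zero]
    mul_assoc := fun a b c => by
      induction a using induction with
      | h0 => simp only [mul_def, map_zero, LinearMap.zero_apply]
      | hadd a a' ha ha' =>
        simp only [mul_def, map_add, LinearMap.add_apply] at *
        rw [ha, ha']
      | hs r g x =>
      induction b using induction with
      | h0 => simp only [mul_def, map_zero, LinearMap.zero_apply]
      | hadd b b' hb hb' =>
        simp only [mul_def, map_add, LinearMap.add_apply] at *
        rw [hb, hb']
      | hs s h y =>
      induction c using induction with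
      | h0 => simp only [mul_def, map_zero]
      | hadd c c' hc hc' =>
        simp only [mul_def, map_add] at *
        rw [hc, hc']
      | hs t k z =>
        have key : elt g x * elt h y * elt k z = elt g x * (elt h y * elt k z) := by
          rw [elt_mul_elt, elt_mul_elt h y]
          by_cases h1 : g = x * h * x⁻¹
          · by_cases h2 : h = y * k * y⁻¹
            · have h3 : g = x * y * k * (x * y)⁻¹ := by rw [h1, h2]; group
              rw [if_pos h1, if_pos h2, elt_mul_elt, elt_mul_elt, if_pos h1, if_pos h3, mul_assoc]
            · have h3 : ¬ g = x * y * k * (x * y)⁻¹ := by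
                intro h3
                apply h2
                have : x * h * x⁻¹ = x * (y * k * y⁻¹) * x⁻¹ := by rw [← h1, h3]; group
                simpa using this
              rw [if_pos h1, if_neg h2, elt_mul_elt, if_neg h3]
              simp only [mul_def, map_zero]
          · rw [if_neg h1]
            by_cases h2 : h = y * k * y⁻¹
            · rw [if_pos h2, elt_mul_elt, if_neg h1]
              simp only [mul_def, map_zero, LinearMap.zero_apply]
            · rw [if_neg h2]
              simp only [mul_def, map_zero, LinearMap.zero_apply]
        simp only [mul_def, map_smul, LinearMap.smul_apply] at *
        rw [key]
    one_mul := fun a => by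
      induction a using induction with
      | h0 => simp only [mul_def, map_zero]
      | hadd a b ha hb =>
        simp only [mul_def, map_add] at *
        rw [ha, hb]
      | hs c h y =>
        have : (1 : DrinfeldDouble G) * elt h y = elt h y := by
          rw [mul_def, one_def, map_sum, LinearMap.sum_apply]
          simp only [← mul_def, elt_mul_elt]
          rw [Finset.sum_eq_single h]
          · rw [if_pos (by group), one_mul]
          · intro g _ hg
            rw [if_neg]
            rintro rfl
            apply hg
            group
          · intro hh
            exact absurd (Finset.mem_univ h) hh
        simp only [mul_def, map_smul] at *
        rw [this]
    mul_one := fun a => by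
      induction a using induction with
      | h0 => simp only [mul_def, map_zero, LinearMap.zero_apply]
      | hadd a b ha hb =>
        simp only [mul_def, map_add, LinearMap.add_apply] at *
        rw [ha, hb]
      | hs c h y =>
        have : elt h y * (1 : DrinfeldDouble G) = elt h y := by
          rw [mul_def, one_def, map_sum]
          simp only [← mul_def, elt_mul_elt]
          rw [Finset.sum_eq_single (y⁻¹ * h * y)]
          · rw [if_pos (by group), mul_one]
          · intro g _ hg
            rw [if_neg]
            rintro rfl
            apply hg
            group
          · intro hh
            exact absurd (Finset.mem_univ _) hh
        simp only [mul_def, map_smul, LinearMap.smul_apply] at *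
        rw [this] }

instance : Algebra ℂ (DrinfeldDouble G) :=
  Algebra.ofModule (fun r a b => by simp only [mul_def, map_smul, LinearMap.smul_apply])
    (fun r a b => by simp only [mul_def, map_smul])

/-- The comultiplication `Δ(e_g ⊗ x) = ∑_{a b = g} (e_a ⊗ x) ⊗ (e_b ⊗ x)` and the counit
`ε(e_g ⊗ x) = δ_{g, 1}` of `D(G)`. -/
instance : CoalgebraStruct ℂ (DrinfeldDouble G) where
  comul := lift fun g x => ∑ a : G, elt a x ⊗ₜ[ℂ] elt (a⁻¹ * g) x
  counit := by
    classical
    exact lift fun g _ => if g = 1 then 1 else 0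

theorem comul_elt (g x : G) :
    Coalgebra.comul (R := ℂ) (elt g x) = ∑ a : G, elt a x ⊗ₜ[ℂ] elt (a⁻¹ * g) x :=
  lift_elt _ g x

open Classical in
theorem counit_elt (g x : G) :
    Coalgebra.counit (R := ℂ) (elt g x) = if g = 1 then 1 else 0 := by
  refine (lift_elt _ g x).trans ?_
  congr

instance : Coalgebra ℂ (DrinfeldDouble G) where
  coassoc := by
    refine lin_ext fun g x => ?_
    simp only [LinearMap.comp_apply, comul_elt, map_sum, LinearMap.rTensor_tmul,
      LinearMap.lTensor_tmul, TensorProduct.sum_tmul, TensorProduct.tmul_sum,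
      LinearEquiv.coe_coe, TensorProduct.assoc_tmul]
    rw [Finset.sum_comm]
    refine Finset.sum_congr rfl fun a _ => ?_
    refine Fintype.sum_equiv (Equiv.mulLeft a⁻¹) _ _ fun b => ?_
    simp [mul_assoc]
  rTensor_counit_comp_comul := by
    refine lin_ext fun g x => ?_
    simp only [LinearMap.comp_apply, comul_elt, map_sum, LinearMap.rTensor_tmul, counit_elt]
    rw [Finset.sum_eq_single 1]
    · simp
    · intro b _ hb; simp [hb]
    · simp
  lTensor_counit_comp_comul := by
    refine lin_ext fun g x => ?_
    simp only [LinearMap.comp_apply, comul_elt, map_sum, LinearMap.lTensor_tmul, counit_elt]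
    rw [Finset.sum_eq_single g]
    · simp
    · intro b _ hb
      have : ¬ b⁻¹ * g = 1 := by rw [inv_mul_eq_one]; exact hb
      simp [this]
    · simp

theorem lin_ext₂ {M : Type*} [AddCommGroup M] [Module ℂ M]
    {φ ψ : DrinfeldDouble G →ₗ[ℂ] DrinfeldDouble G →ₗ[ℂ] M}
    (h : ∀ g x k y, φ (elt g x) (elt k y) = ψ (elt g x) (elt k y)) : φ = ψ :=
  lin_ext fun g x => lin_ext fun k y => h g x k y

instance : Bialgebra ℂ (DrinfeldDouble G) where
  counit_one := by
    classical
    rw [one_def, map_sum]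
    simp [counit_elt]
  comul_one := by
    rw [one_def, map_sum, Algebra.TensorProduct.one_def, one_def]
    simp only [comul_elt, TensorProduct.sum_tmul, TensorProduct.tmul_sum]
    rw [Finset.sum_comm]
    conv_rhs => rw [Finset.sum_comm]
    refine Finset.sum_congr rfl fun a _ => ?_
    exact Fintype.sum_equiv (Equiv.mulLeft a⁻¹) _ _ fun b => by simp
  mul_compr₂_counit := by
    classical
    refine lin_ext₂ fun g x h y => ?_
    simp only [LinearMap.compr₂_apply, LinearMap.compl₁₂_apply, LinearMap.mul_apply',
      elt_mul_elt, counit_elt]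
    by_cases hh : h = 1
    · subst hh
      by_cases hg : g = 1 <;> simp [hg, counit_elt]
    · by_cases hg : g = 1
      · have : ¬ (1 : G) = x * h * x⁻¹ := by
          intro e
          apply hh
          have : x⁻¹ * 1 * x = h := by rw [e]; group
          simpa using this.symm
        simp [hg, hh, this]
      · split_ifs <;> simp [counit_elt, hg]
  mul_compr₂_comul := by
    classical
    refine lin_ext₂ fun g x h y => ?_
    simp only [LinearMap.compr₂_apply, LinearMap.compl₁₂_apply, LinearMap.mul_apply',
      elt_mul_elt, comul_elt, Finset.sum_mul_sum, Algebra.TensorProduct.tmul_mul_tmul]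
    have inner : ∀ a : G,
        (∑ b : G, (if a = x * b * x⁻¹ then elt a (x * y) else 0) ⊗ₜ[ℂ]
          (if a⁻¹ * g = x * (b⁻¹ * h) * x⁻¹ then elt (a⁻¹ * g) (x * y) else 0))
          = if g = x * h * x⁻¹ then
              (elt a (x * y) : DrinfeldDouble G) ⊗ₜ[ℂ] elt (a⁻¹ * g) (x * y) else 0 := by
      intro a
      rw [Finset.sum_eq_single (x⁻¹ * a * x)]
      · have e1 : a = x * (x⁻¹ * a * x) * x⁻¹ := by group
        have e2 : (a⁻¹ * g = x * ((x⁻¹ * a * x)⁻¹ * h) * x⁻¹) ↔ g = x * h * x⁻¹ := by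
          have : x * ((x⁻¹ * a * x)⁻¹ * h) * x⁻¹ = a⁻¹ * (x * h * x⁻¹) := by group
          rw [this, mul_right_inj]
        rw [if_pos e1]
        by_cases hg : g = x * h * x⁻¹
        · rw [if_pos (e2.2 hg), if_pos hg]
        · rw [if_neg (fun h' => hg (e2.1 h')), if_neg hg, TensorProduct.tmul_zero]
      · intro b _ hb
        have : ¬ a = x * b * x⁻¹ := by
          rintro rfl
          apply hb
          group
        rw [if_neg this, TensorProduct.zero_tmul]
      · simp
    rw [Finset.sum_congr rfl fun a _ => inner a]
    by_cases hg : g = x * h * x⁻¹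
    · simp only [if_pos hg, comul_elt]
    · simp [if_neg hg]

/-- The antipode of `D(G)` is `S(e_g ⊗ x) = e_{x⁻¹ g⁻¹ x} ⊗ x⁻¹`. -/
instance : HopfAlgebra ℂ (DrinfeldDouble G) where
  antipode := lift fun g x => elt (x⁻¹ * g⁻¹ * x) x⁻¹
  mul_antipode_rTensor_comul := by
    classical
    refine lin_ext fun g x => ?_
    simp only [LinearMap.comp_apply, comul_elt, map_sum, LinearMap.rTensor_tmul, counit_elt,
      lift_elt, LinearMap.mul'_apply, elt_mul_elt, Algebra.linearMap_apply]
    have e : ∀ a : G, (x⁻¹ * a⁻¹ * x = x⁻¹ * (a⁻¹ * g) * x⁻¹⁻¹) ↔ g = 1 := by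
      intro a
      rw [inv_inv, mul_left_inj, mul_right_inj, eq_comm, mul_eq_left]
    simp only [e]
    by_cases hg : g = 1
    · simp only [hg, if_true, map_one, one_def, inv_mul_cancel]
      refine Fintype.sum_equiv ((Equiv.inv G).trans (MulAut.conj x⁻¹).toEquiv) _ _ fun a => ?_
      simp
    · simp [hg]
  mul_antipode_lTensor_comul := by
    classical
    refine lin_ext fun g x => ?_
    simp only [LinearMap.comp_apply, comul_elt, map_sum, LinearMap.lTensor_tmul, counit_elt,
      lift_elt, LinearMap.mul'_apply, elt_mul_elt, Algebra.linearMap_apply]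
    have e : ∀ a : G, (a = x * (x⁻¹ * (a⁻¹ * g)⁻¹ * x) * x⁻¹) ↔ g = 1 := by
      intro a
      have : x * (x⁻¹ * (a⁻¹ * g)⁻¹ * x) * x⁻¹ = g⁻¹ * a := by group
      rw [this, eq_comm, mul_eq_right, inv_eq_one]
    simp only [e]
    by_cases hg : g = 1
    · simp only [hg, if_true, map_one, one_def, mul_inv_cancel]
    · simp [hg]

end

end DrinfeldDouble

/-! ### Higher Frobenius-Schur indicators -/

section Indicators

/-- `Λ` is a normalized (two-sided) integral of the Hopf algebra `H`. -/
def IsNormalizedIntegral {H : Type*} [Ring H] [HopfAlgebra ℂ H] (Λ : H) : Prop :=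
  (∀ h : H, h * Λ = Coalgebra.counit (R := ℂ) h • Λ) ∧
    (∀ h : H, Λ * h = Coalgebra.counit (R := ℂ) h • Λ) ∧ Coalgebra.counit (R := ℂ) Λ = 1

/-- The Sweedler power `h ↦ h^{[n]} = h₁ h₂ ⋯ hₙ`, with `h^{[0]} = ε(h) 1`. -/
noncomputable def sweedlerPow {H : Type*} [Ring H] [HopfAlgebra ℂ H] : ℕ → H →ₗ[ℂ] H
  | 0 => Algebra.linearMap ℂ H ∘ₗ Coalgebra.counit
  | n + 1 => LinearMap.mul' ℂ H ∘ₗ (sweedlerPow n).rTensor H ∘ₗ Coalgebra.comul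

/-- The normalized integral `Λ = |G|⁻¹ ∑_x e_1 ⊗ x` of `D(G)`. -/
noncomputable def DrinfeldDouble.integral (G : Type u) [Group G] [Fintype G] :
    DrinfeldDouble G :=
  (Fintype.card G : ℂ)⁻¹ • ∑ x : G, DrinfeldDouble.elt 1 x

theorem DrinfeldDouble.isNormalizedIntegral_integral (G : Type u) [Group G] [Fintype G] :
    IsNormalizedIntegral (DrinfeldDouble.integral G) := by
  classical
  have hl : ∀ g x : G, elt g x * ∑ y : G, elt 1 y =
      Coalgebra.counit (R := ℂ) (elt g x) • ∑ y : G, elt 1 y := by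
    intro g x
    simp only [Finset.mul_sum, elt_mul_elt, counit_elt]
    by_cases hg : g = 1
    · simp only [hg, mul_one, mul_inv_cancel, if_true, one_smul]
      exact Fintype.sum_equiv (Equiv.mulLeft x) _ _ fun b => by simp
    · simp [hg]
  have hr : ∀ g x : G, (∑ y : G, elt 1 y) * elt g x =
      Coalgebra.counit (R := ℂ) (elt g x) • ∑ y : G, elt 1 y := by
    intro g x
    simp only [Finset.sum_mul, elt_mul_elt, counit_elt]
    have e : ∀ y : G, (1 = y * g * y⁻¹) ↔ g = 1 := by
      intro y
      rw [eq_comm, mul_inv_eq_one, mul_eq_left]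
    simp only [e]
    by_cases hg : g = 1
    · simp only [hg, if_true, one_smul]
      exact Fintype.sum_equiv (Equiv.mulRight x) _ _ fun b => by simp
    · simp [hg]
  refine ⟨fun h => ?_, fun h => ?_, ?_⟩
  · unfold integral
    rw [mul_smul_comm, smul_comm]
    congr 1
    induction h using induction with
    | h0 => simp
    | hadd a b ha hb => rw [add_mul, map_add, add_smul, ha, hb]
    | hs c g x => rw [smul_mul_assoc, map_smul, smul_assoc, hl]
  · unfold integral
    rw [smul_mul_assoc, smul_comm]
    congr 1
    induction h using induction with
    | h0 => simp
    | hadd a b ha hb => rw [mul_add, map_add, add_smul, ha, hb]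
    | hs c g x => rw [mul_smul_comm, map_smul, smul_assoc, hr]
  · unfold integral
    rw [map_smul, map_sum]
    simp [counit_elt]

/-- The `n`-th Frobenius-Schur indicator `ν_n(V) = χ_V(Λ^{[n]})` of a finite-dimensional
representation `V` of `D(G)`. -/
noncomputable def fsIndicator (G : Type u) [Group G] [Fintype G] (n : ℕ) (V : Type u)
    [AddCommGroup V] [Module ℂ V] [Module (DrinfeldDouble G) V]
    [IsScalarTower ℂ (DrinfeldDouble G) V] : ℂ :=
  LinearMap.trace ℂ V (Algebra.lsmul ℂ ℂ V (sweedlerPow n (DrinfeldDouble.integral G)))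

/-- `G` is an `FSZ_n`-group: `ν_n(V)` is an integer for every irreducible representation `V`
of `D(G)`. -/
def IsFSZn (n : ℕ) (G : Type u) [Group G] [Fintype G] : Prop :=
  ∀ (V : Type u) [AddCommGroup V] [Module ℂ V] [Module (DrinfeldDouble G) V]
    [IsScalarTower ℂ (DrinfeldDouble G) V] [FiniteDimensional ℂ V]
    [IsSimpleModule (DrinfeldDouble G) V], ∃ m : ℤ, fsIndicator G n V = m

/-- `G` is an `FSZ`-group: it is an `FSZ_n`-group for all positive integers `n`. -/
def IsFSZ (G : Type u) [Group G] [Fintype G] : Prop :=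
  ∀ n : ℕ, 0 < n → IsFSZn n G

end Indicators

/-! ### The groups -/

section Groups

/-- A regular `p`-group in the sense of P. Hall: for all `a, b` and every power `q` of `p`,
`(a b)^q = a^q b^q c₁^q ⋯ c_t^q` for some elements `c₁, …, c_t` of the commutator subgroup of the
subgroup generated by `a` and `b`. -/
def IsRegularPGroup (p : ℕ) (G : Type*) [Group G] : Prop :=
  IsPGroup p G ∧ ∀ (a b : G) (k : ℕ), ∃ L : List G,
    (∀ c ∈ L, c ∈ ⁅Subgroup.closure {a, b}, Subgroup.closure {a, b}⁆) ∧
      (a * b) ^ p ^ k = a ^ p ^ k * b ^ p ^ k * (L.map fun c => c ^ p ^ k).prod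

/-- An irregular `p`-group. -/
def IsIrregularPGroup (p : ℕ) (G : Type*) [Group G] : Prop :=
  IsPGroup p G ∧ ¬ IsRegularPGroup p G

/-- The elements `s 0, …, s 5` generate `G` and satisfy the power-commutator relations with
parameters `a, b, x, y, w ∈ ℤ/5` below. The relations allow every element to be written as
`s₀^{i₀} ⋯ s₅^{i₅}` with `0 ≤ i_k < 5`, so a group of order `5 ^ 6` with such elements is
determined by the parameters up to isomorphism. -/
structure IsPcPresented (a b x y w : ZMod 5) {G : Type*} [Group G] (s : Fin 6 → G) : Prop where
  gen : Subgroup.closure (Set.range s) = ⊤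
  pow0 : s 0 ^ 5 = s 5 ^ a.val
  pow1 : s 1 ^ 5 = s 5 ^ b.val
  pow2 : s 2 ^ 5 = 1
  pow3 : s 3 ^ 5 = 1
  pow4 : s 4 ^ 5 = 1
  pow5 : s 5 ^ 5 = 1
  rel10 : s 1 * s 0 = s 0 * s 1 * s 2
  rel20 : s 2 * s 0 = s 0 * s 2 * s 3
  rel30 : s 3 * s 0 = s 0 * s 3 * s 4
  rel40 : s 4 * s 0 = s 0 * s 4 * s 5
  rel21 : s 2 * s 1 = s 1 * s 2 * (s 4 ^ x.val * s 5 ^ y.val)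
  rel31 : s 3 * s 1 = s 1 * s 3 * s 5 ^ (x + w).val
  rel41 : s 4 * s 1 = s 1 * s 4 * s 5 ^ w.val
  rel32 : s 3 * s 2 = s 2 * s 3 * s 5 ^ (-w).val
  rel42 : s 4 * s 2 = s 2 * s 4
  rel43 : s 4 * s 3 = s 3 * s 4
  rel5 : ∀ k : Fin 6, s 5 * s k = s k * s 5

end Groups

/-!
Let `A` be a central subgroup of `G`, `φ` a linear character of `A` and `u : G`. Then
`p = |A|⁻¹ ∑ φ(c) e_u ⊗ c` is an idempotent of `D(G)`, and `ν_n(D(G) p)` is the Fourier coefficient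
at `φ` of the function counting the `t` with `tⁿ = c = (ut)ⁿ`, for `c ∈ A`. If `G` is `FSZ_n`, these
coefficients are integers; if moreover `|A|` is prime, then the powers of a primitive `|A|`-th root
of unity satisfy, up to scaling, only one linear relation over `ℚ`, so the count is the same for all
`c ≠ 1`. In the groups `M(a, b, x, y, w)` the fifth power of `s₀^{c₀} ⋯ s₅^{c₅}` is a power of the
central element `s₅` whose exponent is a polynomial in `c₀` and `c₁`, and for the parameters in
question two of the counts differ.

On a tensor power `V^{⊗n}` the integral `Λ` acts by an idempotent commuting with the cyclic
rotation, and `ν_n(V)` is the trace of their product, hence a sum of `n`-th roots of unity. It is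
also real, because every representation of `D(G)` carries an invariant Hermitian form. So `ν_5(V)`
lies in `ℤ[ζ₅] ∩ ℝ ⊆ ℚ(√5)`.

Finally, `D(F)` is a quotient of `D(F × H)` compatibly with coproducts and integrals, so the
irreducible representations of `D(F)` inflate to `D(F × H)` with the same indicators.
-/

section BialgHom

variable {H K : Type*} [Ring H] [HopfAlgebra ℂ H] [Ring K] [HopfAlgebra ℂ K]

theorem map_sweedlerPow (f : H →ₐc[ℂ] K) (n : ℕ) (h : H) :
    f (sweedlerPow n h) = sweedlerPow n (f h) := by
  induction n generalizing h with
  | zero => simp [sweedlerPow, AlgHomClass.commutes]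
  | succ n ih =>
    have map_mul_rTensor (t : H ⊗[ℂ] H) :
        f (LinearMap.mul' ℂ H ((sweedlerPow n).rTensor H t)) =
          LinearMap.mul' ℂ K
            ((sweedlerPow n).rTensor K (TensorProduct.map (f : H →ₗ[ℂ] K) f t)) := by
      induction t with
      | zero => simp
      | tmul a b => simp [ih]
      | add s t hs ht => simp only [map_add, hs, ht]
    calc f (LinearMap.mul' ℂ H ((sweedlerPow n).rTensor H (Coalgebra.comul h)))
      _ = LinearMap.mul' ℂ K ((sweedlerPow n).rTensor K
            (TensorProduct.map (f : H →ₗ[ℂ] K) f (Coalgebra.comul h))) := map_mul_rTensor _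
      _ = sweedlerPow n.succ (f h) := by
        rw [CoalgHomClass.map_comp_comul_apply]
        rfl

end BialgHom

namespace DrinfeldDouble

variable {F H : Type u} [Group F] [Fintype F] [Group H] [Fintype H]

open Classical in
/-- The algebra map underlying `fstHom`. -/
noncomputable def fstAlgHom (F H : Type u) [Group F] [Fintype F] [Group H] [Fintype H] :
    DrinfeldDouble (F × H) →ₐ[ℂ] DrinfeldDouble F :=
  AlgHom.ofLinearMap (lift fun g x => if g.2 = 1 then elt g.1 x.1 else 0)
    (by simp [one_def, Fintype.sum_prod_type])
    (by
      set π : DrinfeldDouble (F × H) →ₗ[ℂ] DrinfeldDouble F :=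
        lift fun g x => if g.2 = 1 then elt g.1 x.1 else 0
      suffices (mulHom (G := F × H)).compr₂ π = (mulHom (G := F)).compl₁₂ π π from
        fun a b => LinearMap.congr_fun₂ this a b
      have π_elt (g x : F × H) : π (elt g x) = if g.2 = 1 then elt g.1 x.1 else 0 :=
        lift_elt _ g x
      refine lin_ext₂ fun ⟨g₁, g₂⟩ ⟨x₁, x₂⟩ ⟨h₁, h₂⟩ ⟨y₁, y₂⟩ => ?_
      have conj_eq_one : 1 = x₂ * h₂ * x₂⁻¹ ↔ h₂ = 1 := by
        rw [eq_comm, mul_inv_eq_one, mul_eq_left]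
      simp only [LinearMap.compr₂_apply, LinearMap.compl₁₂_apply, ← mul_def, elt_mul_elt,
        apply_ite π, map_zero, π_elt, Prod.mk_mul_mk, Prod.inv_mk, Prod.mk.injEq]
      by_cases hg : g₂ = 1
      · subst hg
        by_cases hh : h₂ = 1 <;> simp [conj_eq_one, hh, elt_mul_elt]
      · simp [hg])

open Classical in
theorem fstAlgHom_elt (g x : F × H) :
    fstAlgHom F H (elt g x) = if g.2 = 1 then elt g.1 x.1 else 0 := by
  rw [fstAlgHom, AlgHom.ofLinearMap_apply, lift_elt]

/-- The bialgebra homomorphism `D(F × H) → D(F)` given by the projection `F × H → F` on group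
elements and by the restriction of functions along `F → F × H`. -/
noncomputable def fstHom (F H : Type u) [Group F] [Fintype F] [Group H] [Fintype H] :
    DrinfeldDouble (F × H) →ₐc[ℂ] DrinfeldDouble F :=
  BialgHom.ofAlgHom (fstAlgHom F H)
    (by
      classical
      refine AlgHom.toLinearMap_injective (lin_ext fun g x => ?_)
      by_cases hg : g.2 = 1 <;> simp [fstAlgHom_elt, counit_elt, Prod.ext_iff, hg])
    (by
      classical
      refine AlgHom.toLinearMap_injective (lin_ext fun ⟨g₁, g₂⟩ x => ?_)
      by_cases hg : g₂ = 1 <;>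
        simp [fstAlgHom_elt, comul_elt, Fintype.sum_prod_type, TensorProduct.ite_tmul, hg])

open Classical in
theorem fstHom_elt (g x : F × H) :
    fstHom F H (elt g x) = if g.2 = 1 then elt g.1 x.1 else 0 :=
  fstAlgHom_elt g x

theorem fstHom_surjective : Function.Surjective (fstHom F H) := by
  intro a
  induction a using induction with
  | h0 => exact ⟨0, map_zero _⟩
  | hadd a b ha hb =>
    obtain ⟨a', rfl⟩ := ha
    obtain ⟨b', rfl⟩ := hb
    exact ⟨a' + b', map_add _ _ _⟩
  | hs c g x => exact ⟨c • elt (g, 1) (x, 1), by rw [map_smul, fstHom_elt, if_pos rfl]⟩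

theorem fstHom_integral : fstHom F H (integral (F × H)) = integral F := by
  have hH : (Fintype.card H : ℂ) ≠ 0 := Nat.cast_ne_zero.2 Fintype.card_ne_zero
  simp only [integral, map_smul, map_sum, fstHom_elt, Prod.snd_one, if_true, Prod.fst_one,
    Fintype.sum_prod_type, Finset.sum_const, Finset.card_univ, Fintype.card_prod, Nat.cast_mul,
    ← Nat.cast_smul_eq_nsmul ℂ, ← Finset.smul_sum, smul_smul]
  rw [mul_inv, mul_assoc, inv_mul_cancel₀ hH, mul_one]

end DrinfeldDouble

theorem IsFSZn.of_prod {F H : Type u} [Group F] [Fintype F] [Group H] [Fintype H] {n : ℕ}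
    (h : IsFSZn n (F × H)) : IsFSZn n F := by
  intro V _ _ _ _ _ _
  let π := DrinfeldDouble.fstHom F H
  let πr : DrinfeldDouble (F × H) →+* DrinfeldDouble F := π
  let _ : Module (DrinfeldDouble (F × H)) V := Module.compHom V πr
  have smul_eq (a : DrinfeldDouble (F × H)) (v : V) : a • v = π a • v := rfl
  have : IsScalarTower ℂ (DrinfeldDouble (F × H)) V :=
    ⟨fun c a v => by rw [smul_eq, smul_eq, map_smul, smul_assoc]⟩
  have : RingHomSurjective πr := ⟨DrinfeldDouble.fstHom_surjective⟩
  have : IsSimpleModule (DrinfeldDouble (F × H)) V :=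
    (LinearMap.isSimpleModule_iff_of_bijective
      (⟨AddHom.id V, fun _ _ => rfl⟩ : V →ₛₗ[πr] V)
      Function.bijective_id).2 inferInstance
  obtain ⟨m, hm⟩ := h V
  refine ⟨m, Eq.trans ?_ hm⟩
  have hΛ : sweedlerPow n (DrinfeldDouble.integral F) =
      π (sweedlerPow n (DrinfeldDouble.integral (F × H))) := by
    rw [map_sweedlerPow, DrinfeldDouble.fstHom_integral]
  rw [fsIndicator, hΛ]
  rfl

theorem trace_eq_trace_restrict_add_trace_mapQ {K V : Type*} [Field K] [AddCommGroup V]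
    [Module K V] [FiniteDimensional K V] (W : Submodule K V) (f : V →ₗ[K] V)
    (hf : ∀ v ∈ W, f v ∈ W) :
    LinearMap.trace K V f =
      LinearMap.trace K W (f.restrict hf) + LinearMap.trace K (V ⧸ W) (W.mapQ W f hf) := by
  obtain ⟨p, hp⟩ := W.subtype.exists_leftInverse_of_injective W.ker_subtype
  have p_apply (w : W) : p w = w := LinearMap.congr_fun hp w
  let s : V ⧸ W →ₗ[K] V := W.liftQ (LinearMap.id - W.subtype ∘ₗ p) fun w hw => by
    simp [p_apply ⟨w, hw⟩]
  have hs : W.mkQ ∘ₗ s = LinearMap.id := Submodule.linearMap_qext _ (by ext; simp [s])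
  calc LinearMap.trace K V f
    _ = LinearMap.trace K V ((f ∘ₗ W.subtype) ∘ₗ p) +
          LinearMap.trace K V ((f ∘ₗ s) ∘ₗ W.mkQ) := by
      rw [← map_add]
      congr 1
      ext v
      simp [s]
    _ = LinearMap.trace K W (p ∘ₗ f ∘ₗ W.subtype) +
          LinearMap.trace K (V ⧸ W) (W.mkQ ∘ₗ f ∘ₗ s) := by
      rw [LinearMap.trace_comp_comm' p, LinearMap.trace_comp_comm' W.mkQ]
    _ = _ := by
      congr 2
      · ext w
        exact congrArg Subtype.val (p_apply (f.restrict hf w))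
      · rw [← LinearMap.comp_assoc, ← W.mapQ_mkQ W f (h := hf), LinearMap.comp_assoc, hs,
          LinearMap.comp_id]

section Modules

variable {G : Type u} [Group G] [Fintype G]

theorem fsIndicator_eq_add_quotient (n : ℕ) {V : Type u} [AddCommGroup V] [Module ℂ V]
    [Module (DrinfeldDouble G) V] [IsScalarTower ℂ (DrinfeldDouble G) V] [FiniteDimensional ℂ V]
    (W : Submodule (DrinfeldDouble G) V) :
    fsIndicator G n V = fsIndicator G n W + fsIndicator G n (V ⧸ W) :=
  trace_eq_trace_restrict_add_trace_mapQ (W.restrictScalars ℂ) _ fun _ hv => W.smul_mem _ hv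

theorem fsIndicator_eq_zero_of_subsingleton (n : ℕ) (V : Type u) [AddCommGroup V] [Module ℂ V]
    [Module (DrinfeldDouble G) V] [IsScalarTower ℂ (DrinfeldDouble G) V] [Subsingleton V] :
    fsIndicator G n V = 0 := by
  rw [fsIndicator, Subsingleton.elim (Algebra.lsmul ℂ ℂ V _) 0, map_zero]

theorem IsFSZn.exists_int_fsIndicator {n : ℕ} (hG : IsFSZn n G) (V : Type u) [AddCommGroup V]
    [Module ℂ V] [Module (DrinfeldDouble G) V] [IsScalarTower ℂ (DrinfeldDouble G) V]
    [FiniteDimensional ℂ V] : ∃ m : ℤ, fsIndicator G n V = m := by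
  have : IsNoetherian (DrinfeldDouble G) V := isNoetherian_of_tower ℂ inferInstance
  have : IsArtinian (DrinfeldDouble G) V := isArtinian_of_tower ℂ inferInstance
  have hV : IsFiniteLength (DrinfeldDouble G) V :=
    isFiniteLength_iff_isNoetherian_isArtinian.2 ⟨inferInstance, inferInstance⟩
  suffices of_isFiniteLength : ∀ (V : Type u) [AddCommGroup V] [Module (DrinfeldDouble G) V],
      IsFiniteLength (DrinfeldDouble G) V → ∀ [Module ℂ V] [IsScalarTower ℂ (DrinfeldDouble G) V]
        [FiniteDimensional ℂ V], ∃ m : ℤ, fsIndicator G n V = m from of_isFiniteLength V hV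
  intro V _ _ hV
  induction hV with
  | of_subsingleton =>
    intros
    exact ⟨0, by rw [fsIndicator_eq_zero_of_subsingleton, Int.cast_zero]⟩
  | @of_simple_quotient V _ _ W _ _ ih =>
    intros
    have : FiniteDimensional ℂ (V ⧸ W) :=
      FiniteDimensional.of_surjective (W.mkQ.restrictScalars ℂ) W.mkQ_surjective
    have : FiniteDimensional ℂ W :=
      FiniteDimensional.of_injective (W.subtype.restrictScalars ℂ) W.injective_subtype
    obtain ⟨m, hm⟩ := ih
    obtain ⟨k, hk⟩ := hG (V ⧸ W)
    exact ⟨m + k, by rw [fsIndicator_eq_add_quotient n W, hm, hk, Int.cast_add]⟩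

end Modules

section PiKronecker

variable {R I : Type*} [CommSemiring R] {n : ℕ}

/-- The Kronecker product of finitely many square matrices of the same size, indexed by tuples:
the matrix of the tensor product of the corresponding endomorphisms. -/
def piKronecker (M : Fin n → Matrix I I R) : Matrix (Fin n → I) (Fin n → I) R :=
  Matrix.of fun i j => ∏ k, M k (i k) (j k)

theorem piKronecker_apply (M : Fin n → Matrix I I R) (i j : Fin n → I) :
    piKronecker M i j = ∏ k, M k (i k) (j k) := rfl

theorem piKronecker_eq_zero {M : Fin n → Matrix I I R} (k : Fin n) (hk : M k = 0) :
    piKronecker M = 0 := by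
  ext i j
  exact Finset.prod_eq_zero (Finset.mem_univ k) (by rw [hk, Matrix.zero_apply])

variable [Fintype I]

theorem piKronecker_mul (M N : Fin n → Matrix I I R) :
    piKronecker M * piKronecker N = piKronecker fun k => M k * N k := by
  ext i j
  simp only [Matrix.mul_apply, piKronecker_apply, ← Finset.prod_mul_distrib,
    Finset.prod_univ_sum, Fintype.piFinset_univ]

variable [DecidableEq I]

theorem prod_ofFn_matrix_apply (M : Fin (n + 1) → Matrix I I R) (a b : I) :
    (List.ofFn M).prod a b = ∑ p : Fin n → I,
      ∏ k, M k (Fin.cons (α := fun _ => I) a p k) (Fin.snoc (α := fun _ => I) p b k) := by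
  induction n generalizing a with
  | zero => simp [Fin.snoc]
  | succ n ih =>
    rw [List.ofFn_succ, List.prod_cons, Matrix.mul_apply,
      ← (Fin.consEquiv fun _ => I).sum_comp, Fintype.sum_prod_type]
    refine Finset.sum_congr rfl fun c _ => ?_
    rw [ih, Finset.mul_sum]
    refine Finset.sum_congr rfl fun p _ => ?_
    change _ = ∏ k, M k (Fin.cons (α := fun _ => I) a (Fin.cons c p : Fin (n + 1) → I) k)
      (Fin.snoc (α := fun _ => I) (Fin.cons c p : Fin (n + 1) → I) b k)
    rw [Fin.prod_univ_succ (n := n + 1), ← Fin.cons_snoc_eq_snoc_cons]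
    simp only [Fin.cons_zero, Fin.cons_succ]

variable (R I n) in
/-- The matrix of the operator permuting the factors of an `n`-th tensor power cyclically. -/
def rotationMatrix : Matrix (Fin n → I) (Fin n → I) R :=
  Equiv.Perm.permMatrix R ((finRotate n).arrowCongr (Equiv.refl I) : Equiv.Perm (Fin n → I))

theorem mul_rotationMatrix_apply (P : Matrix (Fin n → I) (Fin n → I) R) (i j : Fin n → I) :
    (P * rotationMatrix R I n) i j = P i (j ∘ finRotate n) := by
  rw [rotationMatrix, Equiv.Perm.permMatrix, PEquiv.mul_toMatrix_toPEquiv]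
  rfl

theorem rotationMatrix_mul_apply (P : Matrix (Fin n → I) (Fin n → I) R) (i j : Fin n → I) :
    (rotationMatrix R I n * P) i j = P (i ∘ (finRotate n).symm) j := by
  rw [rotationMatrix, Equiv.Perm.permMatrix, PEquiv.toMatrix_toPEquiv_mul]
  rfl

theorem piKronecker_mul_rotationMatrix (M : Fin n → Matrix I I R) :
    piKronecker M * rotationMatrix R I n =
      rotationMatrix R I n * piKronecker (M ∘ (finRotate n).symm) := by
  ext i j
  rw [mul_rotationMatrix_apply, rotationMatrix_mul_apply, piKronecker_apply, piKronecker_apply,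
    ← Equiv.prod_comp (finRotate n) fun k => (M ∘ (finRotate n).symm) k _ _]
  simp only [Function.comp_apply, Equiv.symm_apply_apply]

theorem trace_piKronecker_mul_rotationMatrix (M : Fin (n + 1) → Matrix I I R) :
    (piKronecker M * rotationMatrix R I (n + 1)).trace = (List.ofFn M).prod.trace := by
  simp only [Matrix.trace, Matrix.diag_apply, mul_rotationMatrix_apply, piKronecker_apply,
    prod_ofFn_matrix_apply, Fin.snoc_eq_cons_rotate]
  rw [← (Fin.consEquiv fun _ => I).sum_comp, Fintype.sum_prod_type]
  rfl

theorem finRotate_pow_self : ∀ n : ℕ, finRotate n ^ n = 1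
  | 0 => rfl
  | 1 => Subsingleton.elim _ _
  | n + 2 => by
    have h := pow_orderOf_eq_one (finRotate (n + 2))
    rwa [isCycle_finRotate.orderOf, support_finRotate, Finset.card_univ, Fintype.card_fin] at h

theorem rotationMatrix_pow_self : rotationMatrix R I n ^ n = 1 := by
  have mul_pow_apply (k : ℕ) (P : Matrix (Fin n → I) (Fin n → I) R) (i j : Fin n → I) :
      (P * rotationMatrix R I n ^ k) i j = P i (j ∘ ⇑(finRotate n ^ k)) := by
    induction k generalizing j with
    | zero => simp
    | succ k ih =>
      rw [pow_succ, ← mul_assoc, mul_rotationMatrix_apply, ih, pow_succ', Equiv.Perm.coe_mul]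
      rfl
  ext i j
  rw [← one_mul (rotationMatrix R I n ^ n), mul_pow_apply, finRotate_pow_self, Equiv.Perm.coe_one,
    Function.comp_id]

end PiKronecker

namespace DrinfeldDouble

section Indicators

variable {G : Type u} [Group G] [Fintype G]

open Classical in
theorem sweedlerPow_elt (n : ℕ) (g x : G) :
    sweedlerPow n (elt g x) =
      ∑ a : G, if (a * x⁻¹) ^ n * x ^ n = g then elt a (x ^ n) else 0 := by
  induction n generalizing g with
  | zero =>
    simp only [sweedlerPow, LinearMap.comp_apply, counit_elt, Algebra.linearMap_apply, pow_zero,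
      mul_one]
    by_cases hg : g = 1
    · simp [hg, one_def]
    · simp [hg, Ne.symm hg]
  | succ n ih =>
    simp only [sweedlerPow, LinearMap.comp_apply, comul_elt, map_sum, LinearMap.rTensor_tmul,
      LinearMap.mul'_apply, ih, Finset.sum_mul, ite_mul, zero_mul, elt_mul_elt]
    rw [Finset.sum_comm]
    refine Finset.sum_congr rfl fun a _ => ?_
    rw [Finset.sum_ite_eq, if_pos (Finset.mem_univ _), ← pow_succ]
    refine if_congr ?_ rfl rfl
    rw [eq_mul_inv_iff_mul_eq, mul_inv_rev, mul_assoc, mul_inv_cancel_left, eq_inv_mul_iff_mul_eq,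
      pow_succ, pow_succ' x, mul_assoc _ (a * x⁻¹), mul_assoc a, inv_mul_cancel_left]

open Classical in
theorem sweedlerPow_integral (n : ℕ) :
    sweedlerPow n (integral G) = (Fintype.card G : ℂ)⁻¹ •
      ∑ x : G, ∑ a : G, if (a * x⁻¹) ^ n * x ^ n = 1 then elt a (x ^ n) else 0 := by
  simp only [integral, map_smul, map_sum, sweedlerPow_elt]

/-- The character of a `D(G)`-module, as a linear form on `D(G)`. -/
noncomputable def character (V : Type u) [AddCommGroup V] [Module ℂ V]
    [Module (DrinfeldDouble G) V] [IsScalarTower ℂ (DrinfeldDouble G) V] :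
    DrinfeldDouble G →ₗ[ℂ] ℂ :=
  LinearMap.trace ℂ V ∘ₗ (Algebra.lsmul ℂ ℂ V).toLinearMap

theorem fsIndicator_eq_character (n : ℕ) (V : Type u) [AddCommGroup V] [Module ℂ V]
    [Module (DrinfeldDouble G) V] [IsScalarTower ℂ (DrinfeldDouble G) V] :
    fsIndicator G n V = character V (sweedlerPow n (integral G)) := rfl

end Indicators

section LeftIdeals

variable {G : Type u}

/-- The basis of the elements `elt g x` of `D(G)`. -/
noncomputable def stdBasis (G : Type u) : Module.Basis (G × G) ℂ (DrinfeldDouble G) :=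
  (Finsupp.basisSingleOne : Module.Basis (G × G) ℂ (G × G →₀ ℂ))

theorem stdBasis_apply (i : G × G) : stdBasis G i = elt i.1 i.2 :=
  congrFun Finsupp.coe_basisSingleOne i

open Classical in
theorem stdBasis_repr_elt (g x : G) (i : G × G) :
    (stdBasis G).repr (elt g x) i = if (g, x) = i then 1 else 0 := by
  rw [← stdBasis_apply (g, x), Module.Basis.repr_self, Finsupp.single_apply]

instance [Finite G] : FiniteDimensional ℂ (DrinfeldDouble G) :=
  Module.Finite.of_basis (stdBasis G)

variable [Group G] [Fintype G]

/-- The left ideal `D(G) p`, as the range of right multiplication by `p`. -/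
noncomputable abbrev leftIdeal (p : DrinfeldDouble G) :
    Submodule (DrinfeldDouble G) (DrinfeldDouble G) :=
  LinearMap.range (LinearMap.toSpanSingleton (DrinfeldDouble G) (DrinfeldDouble G) p)

theorem character_leftIdeal {p : DrinfeldDouble G} (hp : p * p = p) (h : DrinfeldDouble G) :
    character (leftIdeal p) h =
      LinearMap.trace ℂ (DrinfeldDouble G)
        (LinearMap.mulLeft ℂ h ∘ₗ LinearMap.mulRight ℂ p) := by
  let i : leftIdeal p →ₗ[ℂ] DrinfeldDouble G := (leftIdeal p).subtype.restrictScalars ℂ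
  let q : DrinfeldDouble G →ₗ[ℂ] leftIdeal p :=
    LinearMap.restrictScalars ℂ
      (LinearMap.toSpanSingleton (DrinfeldDouble G) (DrinfeldDouble G) p).rangeRestrict
  have : FiniteDimensional ℂ (leftIdeal p) :=
    FiniteDimensional.of_injective i (leftIdeal p).injective_subtype
  have act_eq : Algebra.lsmul ℂ ℂ (leftIdeal p) h = q ∘ₗ LinearMap.mulLeft ℂ h ∘ₗ i := by
    ext ⟨v, w, rfl⟩
    change h * (w * p) = h * (w * p) * p
    rw [mul_assoc, mul_assoc, hp]
  calc character (leftIdeal p) h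
    _ = LinearMap.trace ℂ (leftIdeal p) (q ∘ₗ LinearMap.mulLeft ℂ h ∘ₗ i) := by rw [← act_eq]; rfl
    _ = LinearMap.trace ℂ (DrinfeldDouble G) ((LinearMap.mulLeft ℂ h ∘ₗ i) ∘ₗ q) :=
      (LinearMap.trace_comp_comm' _ _).symm

open Classical in
theorem trace_mulLeft_elt_mulRight_elt (a y u : G) {z : G} (hz : ∀ g, z * g = g * z) :
    LinearMap.trace ℂ (DrinfeldDouble G)
        (LinearMap.mulLeft ℂ (elt a y) ∘ₗ LinearMap.mulRight ℂ (elt u z)) =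
      ∑ x : G, if a = x * u * x⁻¹ ∧ y = z⁻¹ then 1 else 0 := by
  have diag_eq (x g : G) : (stdBasis G).repr (elt a y * (elt g x * elt u z)) (g, x) =
      if g = x * u * x⁻¹ then (if a = x * u * x⁻¹ ∧ y = z⁻¹ then 1 else 0) else 0 := by
    have mul_eq_right_iff : y * (x * z) = x ↔ y = z⁻¹ := by
      rw [← hz, ← mul_assoc, mul_eq_right, eq_inv_iff_mul_eq_one]
    rw [elt_mul_elt]
    split_ifs with hg ha
    · obtain ⟨ha, rfl⟩ := ha
      have conj_eq : a = z⁻¹ * g * z⁻¹⁻¹ := by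
        rw [inv_inv, mul_assoc, ← hz, inv_mul_cancel_left, hg, ha]
      rw [elt_mul_elt, if_pos conj_eq, stdBasis_repr_elt, mul_eq_right_iff.2 rfl, hg, ha,
        if_pos rfl]
    · rw [elt_mul_elt]
      split_ifs
      · rw [stdBasis_repr_elt, if_neg fun h => ha
          ⟨(Prod.mk.inj h).1.trans hg, mul_eq_right_iff.1 (Prod.mk.inj h).2⟩]
      · rw [map_zero, Finsupp.zero_apply]
    · rw [mul_zero, map_zero, Finsupp.zero_apply]
  rw [LinearMap.trace_eq_matrix_trace ℂ (stdBasis G), Matrix.trace, Fintype.sum_prod_type,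
    Finset.sum_comm]
  simp only [Matrix.diag_apply, LinearMap.toMatrix_apply, LinearMap.comp_apply,
    LinearMap.mulLeft_apply, LinearMap.mulRight_apply, stdBasis_apply, diag_eq,
    Finset.sum_ite_eq', Finset.mem_univ, if_true]

open Classical in
/-- The number of `t` with `t ^ n = c` and `(u * t) ^ n = c`: these counts, for `c` in a central
subgroup, are the Fourier coefficients of the indicators of the ideals of `centralIdempotent`. -/
noncomputable def powPairCount (n : ℕ) (u c : G) : ℕ :=
  (Finset.univ.filter fun t : G => t ^ n = c ∧ (u * t) ^ n = c).card

open Classical in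
theorem sum_ite_conj_eq_powPairCount (n : ℕ) (u x : G) {z : G} (hz : ∀ g, z * g = g * z) :
    (∑ t : G, if (x * u * x⁻¹ * t⁻¹) ^ n * t ^ n = 1 ∧ t ^ n = z⁻¹ then (1 : ℂ) else 0) =
      powPairCount n u z := by
  have conj_eq_iff (g : G) : x⁻¹ * g * x = z ↔ g = z := by
    rw [mul_assoc, inv_mul_eq_iff_eq_mul, ← hz, mul_left_inj]
  have conj_pow' (g : G) : (x⁻¹ * g * x) ^ n = x⁻¹ * g ^ n * x := by
    simpa only [inv_inv] using conj_pow (i := n) (a := x⁻¹) (b := g)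
  rw [powPairCount, Finset.natCast_card_filter]
  refine Fintype.sum_equiv ((Equiv.inv G).trans (MulAut.conj x⁻¹).toEquiv) _ _ fun t => ?_
  have image_eq : ((Equiv.inv G).trans (MulAut.conj x⁻¹).toEquiv) t = x⁻¹ * t⁻¹ * x := by simp
  have mul_image_eq : u * (x⁻¹ * t⁻¹ * x) = x⁻¹ * (x * u * x⁻¹ * t⁻¹) * x := by group
  refine if_congr ?_ rfl rfl
  rw [image_eq, mul_image_eq, conj_pow', conj_pow', conj_eq_iff, conj_eq_iff, inv_pow,
    inv_eq_iff_eq_inv, and_comm]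
  refine and_congr_right fun ht => ?_
  rw [ht, mul_inv_eq_one]

theorem trace_mulLeft_sweedlerPow_integral_mulRight_elt (n : ℕ) (u : G) {z : G}
    (hz : ∀ g, z * g = g * z) :
    LinearMap.trace ℂ (DrinfeldDouble G)
        (LinearMap.mulLeft ℂ (sweedlerPow n (integral G)) ∘ₗ LinearMap.mulRight ℂ (elt u z)) =
      powPairCount n u z := by
  classical
  let τ : DrinfeldDouble G →ₗ[ℂ] ℂ := LinearMap.trace ℂ (DrinfeldDouble G) ∘ₗ
    LinearMap.lcomp ℂ _ (LinearMap.mulRight ℂ (elt u z)) ∘ₗ LinearMap.mul ℂ (DrinfeldDouble G)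
  have τ_elt (a y : G) : τ (elt a y) = ∑ x : G, if a = x * u * x⁻¹ ∧ y = z⁻¹ then 1 else 0 :=
    trace_mulLeft_elt_mulRight_elt a y u hz
  have collapse (t : G) :
      (∑ a : G, if (a * t⁻¹) ^ n * t ^ n = 1 then τ (elt a (t ^ n)) else 0) =
        ∑ x : G, if (x * u * x⁻¹ * t⁻¹) ^ n * t ^ n = 1 ∧ t ^ n = z⁻¹ then 1 else 0 := by
    simp only [τ_elt, ← Finset.sum_filter (fun a => (a * t⁻¹) ^ n * t ^ n = 1)]
    rw [Finset.sum_comm]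
    refine Finset.sum_congr rfl fun x _ => ?_
    by_cases ht : t ^ n = z⁻¹ <;> simp [ht]
  calc τ (sweedlerPow n (integral G))
    _ = (Fintype.card G : ℂ)⁻¹ *
          ∑ t : G, ∑ a : G, if (a * t⁻¹) ^ n * t ^ n = 1 then τ (elt a (t ^ n)) else 0 := by
      simp only [sweedlerPow_integral, map_smul, map_sum, apply_ite τ, map_zero, smul_eq_mul]
    _ = (Fintype.card G : ℂ)⁻¹ * ∑ x : G, ∑ t : G,
          if (x * u * x⁻¹ * t⁻¹) ^ n * t ^ n = 1 ∧ t ^ n = z⁻¹ then 1 else 0 := by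
      rw [Finset.sum_congr rfl fun t _ => collapse t, Finset.sum_comm]
    _ = powPairCount n u z := by
      rw [Finset.sum_congr rfl fun x _ => sum_ite_conj_eq_powPairCount n u x hz, Finset.sum_const,
        Finset.card_univ, nsmul_eq_mul, inv_mul_cancel_left₀]
      exact Nat.cast_ne_zero.2 Fintype.card_ne_zero

variable {A : Type*} [Group A] [Fintype A]

/-- The idempotent `|A|⁻¹ ∑ c, φ c • (e_u ⊗ ι c)` of `D(G)` attached to an element `u`, a
homomorphism `ι` with central image and a linear character `φ` of its source. -/
noncomputable def centralIdempotent (ι : A →* G) (φ : A →* ℂ) (u : G) : DrinfeldDouble G :=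
  (Fintype.card A : ℂ)⁻¹ • ∑ c : A, φ c • elt u (ι c)

theorem centralIdempotent_mul_self {ι : A →* G} (hι : ∀ c g, ι c * g = g * ι c) (φ : A →* ℂ)
    (u : G) : centralIdempotent ι φ u * centralIdempotent ι φ u = centralIdempotent ι φ u := by
  classical
  have card_ne_zero : (Fintype.card A : ℂ) ≠ 0 := Nat.cast_ne_zero.2 Fintype.card_ne_zero
  have sum_translate (c : A) : ∑ d : A, φ c • elt u (ι c) * φ d • elt u (ι d) =
      ∑ d : A, φ d • elt u (ι d) := by
    refine Fintype.sum_equiv (Equiv.mulLeft c) _ _ fun d => ?_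
    have conj_eq : u = ι c * u * (ι c)⁻¹ := by rw [hι, mul_inv_cancel_right]
    rw [smul_mul_smul_comm, elt_mul_elt, if_pos conj_eq, Equiv.coe_mulLeft, map_mul, map_mul]
  rw [centralIdempotent, smul_mul_smul_comm, mul_smul, Finset.sum_mul_sum,
    Finset.sum_congr rfl fun c _ => sum_translate c, Finset.sum_const, Finset.card_univ,
    ← Nat.cast_smul_eq_nsmul ℂ, inv_smul_smul₀ card_ne_zero]

theorem fsIndicator_leftIdeal_centralIdempotent (n : ℕ) {ι : A →* G}
    (hι : ∀ c g, ι c * g = g * ι c) (φ : A →* ℂ) (u : G) :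
    fsIndicator G n (leftIdeal (centralIdempotent ι φ u)) =
      (Fintype.card A : ℂ)⁻¹ * ∑ c : A, φ c * powPairCount n u (ι c) := by
  let τ : DrinfeldDouble G →ₗ[ℂ] ℂ := LinearMap.trace ℂ (DrinfeldDouble G) ∘ₗ
    LinearMap.llcomp ℂ _ _ _ (LinearMap.mulLeft ℂ (sweedlerPow n (integral G))) ∘ₗ
      (LinearMap.mul ℂ (DrinfeldDouble G)).flip
  calc fsIndicator G n (leftIdeal (centralIdempotent ι φ u))
    _ = τ (centralIdempotent ι φ u) := by
      rw [fsIndicator_eq_character, character_leftIdeal (centralIdempotent_mul_self hι φ u)]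
      rfl
    _ = (Fintype.card A : ℂ)⁻¹ * ∑ c : A, φ c * τ (elt u (ι c)) := by
      simp only [centralIdempotent, map_smul, map_sum, smul_eq_mul]
    _ = _ := by
      simp only [← trace_mulLeft_sweedlerPow_integral_mulRight_elt n u (hι _)]
      rfl

end LeftIdeals

end DrinfeldDouble

open DrinfeldDouble in
theorem IsFSZn.exists_int_sum_powPairCount {G : Type u} [Group G] [Fintype G] {A : Type*}
    [Group A] [Fintype A] {n : ℕ} (hG : IsFSZn n G) {ι : A →* G}
    (hι : ∀ c g, ι c * g = g * ι c) (φ : A →* ℂ) (u : G) :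
    ∃ m : ℤ, ∑ c : A, φ c * powPairCount n u (ι c) = m := by
  obtain ⟨m, hm⟩ := hG.exists_int_fsIndicator (leftIdeal (centralIdempotent ι φ u))
  refine ⟨Fintype.card A * m, ?_⟩
  have card_ne_zero : (Fintype.card A : ℂ) ≠ 0 := Nat.cast_ne_zero.2 Fintype.card_ne_zero
  rw [fsIndicator_leftIdeal_centralIdempotent n hι, inv_mul_eq_iff_eq_mul₀ card_ne_zero] at hm
  rw [hm, Int.cast_mul, Int.cast_natCast]

theorem eq_of_sum_mul_pow_val_eq_zero {K : Type*} [Field K] [CharZero K] {p : ℕ} [Fact p.Prime]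
    {ζ : K} (hζ : IsPrimitiveRoot ζ p) {c : ZMod p → ℚ} (h : ∑ s, (c s : K) * ζ ^ s.val = 0)
    (s t : ZMod p) : c s = c t := by
  have hp : p.Prime := Fact.out
  obtain ⟨q, rfl⟩ : ∃ q, p = q + 1 := ⟨p - 1, (Nat.succ_pred_eq_of_pos hp.pos).symm⟩
  have natDegree_minpoly : (minpoly ℚ ζ).natDegree = q := by
    rw [← Polynomial.cyclotomic_eq_minpoly_rat hζ hp.pos, Polynomial.natDegree_cyclotomic,
      Nat.totient_prime hp, Nat.add_sub_cancel]
  have linearIndependent : LinearIndependent ℚ fun i : Fin q => ζ ^ (i : ℕ) :=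
    (linearIndependent_pow ζ).comp (Fin.cast natDegree_minpoly.symm) (Fin.cast_injective _)
  suffices eq_last : ∀ s, c s = c (Fin.last q) from (eq_last s).trans (eq_last t).symm
  have sum_eq_zero : ∑ i : Fin q, (c i.castSucc - c (Fin.last q)) • ζ ^ (i : ℕ) = 0 := by
    have geom_sum := hζ.geom_sum_eq_zero hp.one_lt
    rw [Finset.sum_range_succ, Finset.sum_range] at geom_sum
    change ∑ s : Fin (q + 1), (c s : K) * ζ ^ (s : ℕ) = 0 at h
    rw [Fin.sum_univ_castSucc] at h
    simp only [Fin.val_castSucc, Fin.val_last] at h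
    simp only [Rat.smul_def, Rat.cast_sub, sub_mul, Finset.sum_sub_distrib, ← Finset.mul_sum]
    linear_combination h - (c (Fin.last q) : K) * geom_sum
  intro s
  induction s using Fin.lastCases with
  | last => rfl
  | cast i =>
    exact sub_eq_zero.1 (Fintype.linearIndependent_iff.1 linearIndependent _ sum_eq_zero i)

open DrinfeldDouble in
theorem IsFSZn.powPairCount_eq {G : Type u} [Group G] [Fintype G] {n p : ℕ} [Fact p.Prime]
    (hG : IsFSZn n G) {ι : Multiplicative (ZMod p) →* G} (hι : ∀ c g, ι c * g = g * ι c) (u : G)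
    {s t : Multiplicative (ZMod p)} (hs : s ≠ 1) (ht : t ≠ 1) :
    powPairCount n u (ι s) = powPairCount n u (ι t) := by
  have hζ := Complex.isPrimitiveRoot_exp p (NeZero.ne p)
  let φ := AddChar.zmodChar p hζ.pow_eq_one
  obtain ⟨m, hm⟩ := hG.exists_int_sum_powPairCount hι φ.toMonoidHom u
  let c : ZMod p → ℚ := fun r =>
    powPairCount n u (ι (Multiplicative.ofAdd r)) - if r = 0 then (m : ℚ) else 0
  have sum_eq_zero : ∑ r, (c r : ℂ) * Complex.exp (2 * Real.pi * Complex.I / p) ^ r.val = 0 := by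
    rw [← sub_eq_zero.2 hm]
    simp only [c, Rat.cast_sub, sub_mul, Finset.sum_sub_distrib]
    congr 1
    · exact Fintype.sum_equiv Multiplicative.ofAdd _ _ fun r => by
        simp [φ, AddChar.zmodChar_apply, mul_comm]
    · rw [Fintype.sum_eq_single 0 fun r hr => by rw [if_neg hr, Rat.cast_zero, zero_mul],
        if_pos rfl, ZMod.val_zero, pow_zero, mul_one, Rat.cast_intCast]
  have c_toAdd {r : Multiplicative (ZMod p)} (hr : r ≠ 1) : c r.toAdd = powPairCount n u (ι r) := by
    simp [c, hr]
  have hst := eq_of_sum_mul_pow_val_eq_zero hζ sum_eq_zero s.toAdd t.toAdd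
  rwa [c_toAdd hs, c_toAdd ht, Nat.cast_inj] at hst

theorem trace_mem_adjoin_of_pow_succ_eq_self {K ι : Type*} [Field K] [IsAlgClosed K] [Fintype ι]
    [DecidableEq ι] {n : ℕ} [NeZero n] {E : Matrix ι ι K} (hE : E ^ (n + 1) = E) {ζ : K}
    (hζ : IsPrimitiveRoot ζ n) : E.trace ∈ Algebra.adjoin ℤ {ζ} := by
  rw [Matrix.trace_eq_sum_roots_charpoly]
  refine multiset_sum_mem _ fun μ hμ => ?_
  have hasEigenvalue : Module.End.HasEigenvalue (Matrix.toLin' E) μ := by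
    rw [Module.End.hasEigenvalue_iff_mem_spectrum, Matrix.spectrum_toLin']
    exact Matrix.mem_spectrum_of_isRoot_charpoly (Polynomial.isRoot_of_mem_roots hμ)
  obtain ⟨v, hv⟩ := hasEigenvalue.exists_hasEigenvector
  have pow_eq_self : μ ^ (n + 1) = μ := by
    refine smul_left_injective K hv.2 ?_
    change μ ^ (n + 1) • v = μ • v
    rw [← hv.pow_apply, ← hv.apply_eq_smul, ← Matrix.toLin'_pow, hE]
  obtain rfl | μ_ne_zero := eq_or_ne μ 0
  · exact zero_mem _
  · obtain ⟨i, -, rfl⟩ := hζ.eq_pow_of_pow_eq_one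
      (mul_right_cancel₀ μ_ne_zero (by rw [← pow_succ, pow_eq_self, one_mul]))
    exact pow_mem (Algebra.self_mem_adjoin_singleton ℤ ζ) i

theorem prod_ofFn_comp_finRotate_eq_one_iff {M : Type*} [Monoid M]
    [IsDedekindFiniteMonoid M] {n : ℕ} (a : Fin n → M) :
    (List.ofFn (a ∘ finRotate n)).prod = 1 ↔ (List.ofFn a).prod = 1 := by
  obtain _ | n := n
  · rfl
  rw [List.ofFn_succ (f := a), List.ofFn_succ_last, List.prod_append, List.prod_singleton,
    List.prod_cons, mul_eq_one_comm]
  simp [Fin.coeSucc_eq_succ]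

namespace DrinfeldDouble

variable {G : Type u} [Group G]

open Classical in
theorem sweedlerPow_elt_eq_sum_ofFn [Fintype G] (n : ℕ) (g x : G) :
    sweedlerPow n (elt g x) = ∑ a : Fin n → G,
      if (List.ofFn a).prod = g then (List.ofFn fun k => elt (a k) x).prod else 0 := by
  induction n generalizing g with
  | zero =>
    by_cases hg : 1 = g <;> simp [sweedlerPow, counit_elt, hg, eq_comm (b := (1 : G))]
  | succ n ih =>
    simp only [sweedlerPow, LinearMap.comp_apply, comul_elt, map_sum, LinearMap.rTensor_tmul,
      LinearMap.mul'_apply, ih, Finset.sum_mul, ite_mul, zero_mul]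
    rw [Finset.sum_comm, ← (Fin.snocEquiv fun _ => G).sum_comp, Fintype.sum_prod_type,
      Finset.sum_comm (γ := G)]
    refine Finset.sum_congr rfl fun a _ => ?_
    simp only [List.ofFn_succ_last, Fin.snocEquiv_apply, Fin.snoc_castSucc, Fin.snoc_last,
      List.prod_append, List.prod_singleton, ← eq_inv_mul_iff_mul_eq, Finset.sum_ite_eq',
      Finset.sum_ite_eq, Finset.mem_univ, if_true]

section TensorPower

variable {I : Type*} [Fintype I]

open Classical in
/-- The action of `D(G)` on the `n`-th tensor power of a matrix representation `ρ`, through the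
iterated coproduct of `D(G)`. -/
noncomputable def tensorPow [Fintype G] [DecidableEq I] (n : ℕ)
    (ρ : DrinfeldDouble G →ₐ[ℂ] Matrix I I ℂ) :
    DrinfeldDouble G →ₗ[ℂ] Matrix (Fin n → I) (Fin n → I) ℂ :=
  lift fun g x => ∑ a : Fin n → G,
    if (List.ofFn a).prod = g then piKronecker fun k => ρ (elt (a k) x) else 0

variable [Fintype G] [DecidableEq I] {n : ℕ} (ρ : DrinfeldDouble G →ₐ[ℂ] Matrix I I ℂ)

open Classical in
theorem tensorPow_elt (g x : G) :
    tensorPow n ρ (elt g x) = ∑ a : Fin n → G,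
      if (List.ofFn a).prod = g then piKronecker fun k => ρ (elt (a k) x) else 0 :=
  lift_elt _ g x

open Classical in
theorem piKronecker_elt_mul_piKronecker_elt (a b : Fin n → G) (x y : G) :
    (piKronecker fun k => ρ (elt (a k) x)) * piKronecker (fun k => ρ (elt (b k) y)) =
      if a = fun k => x * b k * x⁻¹ then piKronecker fun k => ρ (elt (a k) (x * y)) else 0 := by
  simp only [piKronecker_mul, ← map_mul, elt_mul_elt]
  split_ifs with hab
  · subst hab
    simp only [if_true]
  · obtain ⟨k, hk⟩ := Function.ne_iff.1 hab
    exact piKronecker_eq_zero k ((congrArg ρ (if_neg hk)).trans (map_zero ρ))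

theorem tensorPow_mul (h k : DrinfeldDouble G) :
    tensorPow n ρ (h * k) = tensorPow n ρ h * tensorPow n ρ k := by
  classical
  let T := tensorPow n ρ
  suffices (LinearMap.mul ℂ (DrinfeldDouble G)).compr₂ T =
      (LinearMap.mul ℂ (Matrix (Fin n → I) (Fin n → I) ℂ)).compl₁₂ T T from
    LinearMap.congr_fun₂ this h k
  refine lin_ext₂ fun g x h y => ?_
  let K (a : Fin n → G) := piKronecker fun k => ρ (elt (a k) (x * y))
  let conj : (Fin n → G) ≃ (Fin n → G) := Equiv.piCongrRight fun _ => (MulAut.conj x).toEquiv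
  have prod_conj (b : Fin n → G) : (List.ofFn (conj b)).prod = x * (List.ofFn b).prod * x⁻¹ := by
    rw [← MulAut.conj_apply, map_list_prod, List.map_ofFn]
    rfl
  have prod_conj_eq_iff (b : Fin n → G) :
      (g = x * h * x⁻¹ ∧ (List.ofFn (conj b)).prod = g) ↔
        ((List.ofFn b).prod = h ∧ (List.ofFn (conj b)).prod = g) :=
    and_congr_left fun hb => by
      rw [← hb, prod_conj, mul_left_inj, mul_right_inj]
  calc T (elt g x * elt h y)
    _ = ∑ a : Fin n → G, if g = x * h * x⁻¹ ∧ (List.ofFn a).prod = g then K a else 0 := by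
      rw [elt_mul_elt, apply_ite T, map_zero, Finset.sum_congr rfl fun _ _ => ite_and ..]
      split_ifs <;> simp [T, K, tensorPow_elt]
    _ = ∑ b : Fin n → G,
          if (List.ofFn b).prod = h ∧ (List.ofFn (conj b)).prod = g then K (conj b) else 0 := by
      rw [← conj.sum_comp]
      simp only [prod_conj_eq_iff, K]
    _ = ∑ b : Fin n → G, ∑ a : Fin n → G,
          if (List.ofFn b).prod = h ∧ (List.ofFn a).prod = g then
            (if a = conj b then K a else 0) else 0 := by
      refine Finset.sum_congr rfl fun b _ => ?_
      rw [Fintype.sum_eq_single (conj b) fun a ha => by simp only [if_neg ha, ite_self],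
        if_pos rfl]
    _ = T (elt g x) * T (elt h y) := by
      simp only [T, tensorPow_elt, Finset.sum_mul_sum, ite_mul, mul_ite, zero_mul, mul_zero,
        piKronecker_elt_mul_piKronecker_elt, ite_and]
      exact Finset.sum_comm

theorem trace_tensorPow_mul_rotationMatrix (h : DrinfeldDouble G) :
    (tensorPow (n + 1) ρ h * rotationMatrix ℂ I (n + 1)).trace =
      (ρ (sweedlerPow (n + 1) h)).trace := by
  classical
  suffices Matrix.traceLinearMap _ ℂ ℂ ∘ₗ
      LinearMap.mulRight ℂ (rotationMatrix ℂ I (n + 1)) ∘ₗ tensorPow (n + 1) ρ =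
        Matrix.traceLinearMap I ℂ ℂ ∘ₗ ρ.toLinearMap ∘ₗ sweedlerPow (n + 1) from
    LinearMap.congr_fun this h
  refine lin_ext fun g x => ?_
  simp only [LinearMap.comp_apply, tensorPow_elt, sweedlerPow_elt_eq_sum_ofFn, map_sum,
    AlgHom.toLinearMap_apply]
  refine Finset.sum_congr rfl fun a _ => ?_
  split_ifs
  · simp only [map_list_prod, List.map_ofFn, LinearMap.mulRight_apply,
      Matrix.traceLinearMap_apply, trace_piKronecker_mul_rotationMatrix]
    rfl
  · simp only [map_zero]

theorem commute_tensorPow_integral_rotationMatrix :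
    Commute (tensorPow n ρ (integral G)) (rotationMatrix ℂ I n) := by
  classical
  simp only [integral, map_smul, map_sum]
  refine (Commute.sum_left _ _ _ fun x _ => ?_).smul_left _
  simp only [Commute, SemiconjBy, tensorPow_elt, Finset.sum_mul, Finset.mul_sum, ite_mul, mul_ite,
    zero_mul, mul_zero]
  refine Fintype.sum_equiv ((finRotate n).arrowCongr (Equiv.refl G)) _ _ fun a => ?_
  have rotate_comp : ((finRotate n).arrowCongr (Equiv.refl G) a) ∘ finRotate n = a := by
    ext k
    simp only [Function.comp_apply, Equiv.arrowCongr_apply, Equiv.symm_apply_apply,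
      Equiv.refl_apply]
  refine if_congr ?_ (piKronecker_mul_rotationMatrix _) rfl
  rw [← prod_ofFn_comp_finRotate_eq_one_iff (Equiv.arrowCongr _ _ a), rotate_comp]

theorem trace_sweedlerPow_integral_mem_adjoin [NeZero n] {ζ : ℂ} (hζ : IsPrimitiveRoot ζ n) :
    (ρ (sweedlerPow n (integral G))).trace ∈ Algebra.adjoin ℤ {ζ} := by
  let P := tensorPow n ρ (integral G)
  let R := rotationMatrix ℂ I n
  have P_idempotent : IsIdempotentElem P := by
    obtain ⟨mul_integral, -, counit_integral⟩ := isNormalizedIntegral_integral G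
    rw [IsIdempotentElem, ← tensorPow_mul, mul_integral, counit_integral, one_smul]
  have PR_pow : (P * R) ^ (n + 1) = P * R := by
    rw [(commute_tensorPow_integral_rotationMatrix ρ).mul_pow, P_idempotent.pow_succ_eq, pow_succ,
      rotationMatrix_pow_self, one_mul]
  obtain ⟨n, rfl⟩ := Nat.exists_eq_succ_of_ne_zero (NeZero.ne n)
  rw [← trace_tensorPow_mul_rotationMatrix]
  exact trace_mem_adjoin_of_pow_succ_eq_self PR_pow hζ

end TensorPower

variable [Fintype G]

theorem exists_matrix_trace_eq_character (V : Type u) [AddCommGroup V] [Module ℂ V]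
    [Module (DrinfeldDouble G) V] [IsScalarTower ℂ (DrinfeldDouble G) V] [FiniteDimensional ℂ V] :
    ∃ (d : ℕ) (ρ : DrinfeldDouble G →ₐ[ℂ] Matrix (Fin d) (Fin d) ℂ),
      ∀ h, (ρ h).trace = character V h := by
  let b := Module.finBasis ℂ V
  exact ⟨_, (LinearMap.toMatrixAlgEquiv b).toAlgHom.comp (Algebra.lsmul ℂ ℂ V),
    fun h => (LinearMap.trace_eq_matrix_trace ℂ b _).symm⟩

theorem fsIndicator_mem_adjoin (n : ℕ) [NeZero n] {ζ : ℂ} (hζ : IsPrimitiveRoot ζ n) (V : Type u)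
    [AddCommGroup V] [Module ℂ V] [Module (DrinfeldDouble G) V]
    [IsScalarTower ℂ (DrinfeldDouble G) V] [FiniteDimensional ℂ V] :
    fsIndicator G n V ∈ Algebra.adjoin ℤ {ζ} := by
  obtain ⟨d, ρ, hρ⟩ := exists_matrix_trace_eq_character (G := G) V
  rw [fsIndicator_eq_character, ← hρ]
  exact trace_sweedlerPow_integral_mem_adjoin ρ hζ

end DrinfeldDouble

open Matrix ComplexOrder in
theorem isUnit_sum_conjTranspose_mul_self {κ ι : Type*} [Fintype κ] [Fintype ι] [DecidableEq ι]
    {A : κ → Matrix ι ι ℂ} (hA : ∀ v, (∀ k, A k *ᵥ v = 0) → v = 0) :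
    IsUnit (∑ k, (A k)ᴴ * A k) := by
  let B : Matrix (κ × ι) ι ℂ := Matrix.of fun p j => A p.1 p.2 j
  have conjTranspose_mul_self_B : Bᴴ * B = ∑ k, (A k)ᴴ * A k := by
    ext i j
    simp only [mul_apply, Matrix.sum_apply, Fintype.sum_prod_type, conjTranspose_apply, B, of_apply]
  have mulVec_injective : Function.Injective B.mulVec := by
    refine (injective_iff_map_eq_zero B.mulVecLin).2 fun v hv => hA v fun k => ?_
    exact funext fun i => congrFun hv (k, i)
  rw [← conjTranspose_mul_self_B]
  exact (PosDef.conjTranspose_mul_self B mulVec_injective).isUnit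

namespace DrinfeldDouble

variable {G : Type u} [Group G] [Fintype G]

open Matrix in
/-- The Hermitian form `∑ ρ(e_g ⊗ x)ᴴ ρ(e_g ⊗ x)` attached to a matrix representation `ρ` of
`D(G)`; it is invariant for the `*`-structure `e_g ⊗ x ↦ e_{x⁻¹gx} ⊗ x⁻¹` of `D(G)`. -/
noncomputable def invariantForm {ι : Type*} [Fintype ι] [DecidableEq ι]
    (ρ : DrinfeldDouble G →ₐ[ℂ] Matrix ι ι ℂ) : Matrix ι ι ℂ :=
  ∑ p : G × G, (ρ (elt p.1 p.2))ᴴ * ρ (elt p.1 p.2)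

section InvariantForm

variable {ι : Type*} [Fintype ι] [DecidableEq ι] (ρ : DrinfeldDouble G →ₐ[ℂ] Matrix ι ι ℂ)

theorem isUnit_invariantForm : IsUnit (invariantForm ρ) := by
  refine isUnit_sum_conjTranspose_mul_self fun v hv => ?_
  calc v = (ρ 1).mulVec v := by rw [map_one, Matrix.one_mulVec]
    _ = 0 := by
      rw [one_def, map_sum, Matrix.sum_mulVec]
      exact Finset.sum_eq_zero fun g _ => hv (g, 1)

open Matrix in
theorem conjTranspose_elt_mul_invariantForm (h y : G) :
    (ρ (elt h y))ᴴ * invariantForm ρ = invariantForm ρ * ρ (elt (y⁻¹ * h * y) y⁻¹) := by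
  classical
  have left_eq : (ρ (elt h y))ᴴ * invariantForm ρ =
      ∑ x : G, (ρ (elt (x * h * x⁻¹) (x * y)))ᴴ * ρ (elt (x * h * x⁻¹) x) := by
    simp only [invariantForm, Finset.mul_sum, ← mul_assoc, ← conjTranspose_mul, ← map_mul,
      elt_mul_elt, apply_ite ρ, map_zero, apply_ite conjTranspose, conjTranspose_zero, ite_mul,
      zero_mul, Fintype.sum_prod_type_right, Finset.sum_ite_eq', Finset.mem_univ, if_true]
  have right_eq (k w : G) : invariantForm ρ * ρ (elt k w) =
      ∑ x : G, (ρ (elt (x * k * x⁻¹) x))ᴴ * ρ (elt (x * k * x⁻¹) (x * w)) := by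
    simp only [invariantForm, Finset.sum_mul, mul_assoc, ← map_mul, elt_mul_elt, apply_ite ρ,
      map_zero, mul_ite, mul_zero, Fintype.sum_prod_type_right, Finset.sum_ite_eq',
      Finset.mem_univ, if_true]
  rw [left_eq, right_eq]
  refine Fintype.sum_equiv (Equiv.mulRight y) _ _ fun x => ?_
  have conj_eq : x * y * (y⁻¹ * h * y) * (x * y)⁻¹ = x * h * x⁻¹ := by group
  rw [Equiv.coe_mulRight, conj_eq, mul_inv_cancel_right]

theorem star_trace_elt (h y : G) :
    star (ρ (elt h y)).trace = (ρ (elt (y⁻¹ * h * y) y⁻¹)).trace := by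
  obtain ⟨H, hH⟩ := isUnit_invariantForm ρ
  rw [← Matrix.trace_conjTranspose, ← Matrix.trace_units_conj H (ρ (elt (y⁻¹ * h * y) y⁻¹)), hH,
    ← conjTranspose_elt_mul_invariantForm, ← hH, Units.mul_inv_cancel_right]

end InvariantForm

theorem star_fsIndicator (n : ℕ) (V : Type u) [AddCommGroup V] [Module ℂ V]
    [Module (DrinfeldDouble G) V] [IsScalarTower ℂ (DrinfeldDouble G) V] [FiniteDimensional ℂ V] :
    star (fsIndicator G n V) = fsIndicator G n V := by
  classical
  obtain ⟨d, ρ, hρ⟩ := exists_matrix_trace_eq_character (G := G) V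
  have star_character (h y : G) :
      star (character V (elt h y)) = character V (elt (y⁻¹ * h * y) y⁻¹) := by
    rw [← hρ, ← hρ, star_trace_elt]
  simp only [fsIndicator_eq_character, sweedlerPow_integral, map_smul, map_sum,
    apply_ite (character V), map_zero, smul_eq_mul, star_mul', star_sum, apply_ite star, star_zero,
    star_character, star_inv₀, star_natCast]
  -- On the support of the sum `(a * x⁻¹) ^ n` is the inverse of `x ^ n`, so both commute with `a`.
  refine congrArg _ (Finset.sum_comm.trans ((Finset.sum_congr rfl fun a _ =>
    Fintype.sum_equiv ((Equiv.inv G).trans (Equiv.mulLeft a)) _ _ fun x => ?_).trans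
      Finset.sum_comm))
  obtain ⟨t, rfl⟩ : ∃ t, a = t * x := ⟨a * x⁻¹, (inv_mul_cancel_right a x).symm⟩
  have condition_eq : (t * x * t⁻¹) ^ n * t ^ n = 1 ↔ t ^ n * x ^ n = 1 := by
    rw [conj_pow, mul_assoc, (Commute.refl t).inv_left.pow_right n, ← mul_assoc, mul_assoc t,
      mul_inv_eq_one, mul_eq_left, mul_eq_one_comm]
  simp only [Equiv.trans_apply, Equiv.inv_apply, Equiv.coe_mulLeft, mul_inv_cancel_right,
    condition_eq]
  refine if_ctx_congr Iff.rfl (fun h => ?_) fun _ => rfl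
  have inv_pow_eq : (x ^ n)⁻¹ = t ^ n := inv_eq_of_mul_eq_one_left h
  have commute_pow : Commute (t * x) (x ^ n) := by
    refine Commute.mul_left ?_ (Commute.self_pow x n)
    rw [← inv_inv (x ^ n), inv_pow_eq]
    exact (Commute.self_pow t n).inv_right
  rw [mul_assoc, commute_pow.eq, inv_mul_cancel_left, inv_pow_eq]

end DrinfeldDouble

theorem add_star_mem_span_sqrt_five_of_pow_eq_one {ξ : ℂ} (hξ : ξ ^ 5 = 1) :
    ξ + star ξ ∈ Submodule.span ℚ {1, ((√5 : ℝ) : ℂ)} := by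
  have star_eq : star ξ = ξ ^ 4 := by
    rw [RCLike.star_def, ← Complex.inv_eq_conj (Complex.norm_eq_one_of_pow_eq_one hξ (by decide))]
    exact inv_eq_of_mul_eq_one_right (by rw [← pow_succ', hξ])
  have sqrt_sq : ((√5 : ℝ) : ℂ) ^ 2 = 5 := by
    rw [← Complex.ofReal_pow, Real.sq_sqrt (by norm_num)]
    norm_num
  simp only [Submodule.mem_span_pair, Rat.smul_def, star_eq]
  have factor : (ξ - 1) * (1 + ξ + ξ ^ 2 + ξ ^ 3 + ξ ^ 4) = 0 := by linear_combination hξ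
  obtain h | geom_sum := mul_eq_zero.1 factor
  · refine ⟨2, 0, ?_⟩
    rw [sub_eq_zero.1 h]
    norm_num
  have quadratic :
      (2 * (ξ + ξ ^ 4) + 1 - (√5 : ℝ)) * (2 * (ξ + ξ ^ 4) + 1 + (√5 : ℝ)) = 0 := by
    linear_combination 4 * geom_sum + (8 + 4 * ξ ^ 3) * hξ - sqrt_sq
  obtain h | h := mul_eq_zero.1 quadratic
  · refine ⟨-1 / 2, 1 / 2, ?_⟩
    push_cast
    linear_combination -h / 2
  · refine ⟨-1 / 2, -1 / 2, ?_⟩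
    push_cast
    linear_combination -h / 2

theorem add_star_mem_span_sqrt_five {ζ : ℂ} (hζ : ζ ^ 5 = 1) {z : ℂ}
    (hz : z ∈ Algebra.adjoin ℤ {ζ}) : z + star z ∈ Submodule.span ℚ {1, ((√5 : ℝ) : ℂ)} := by
  rw [← Subalgebra.mem_toSubmodule, Algebra.adjoin_eq_span] at hz
  induction hz using Submodule.span_induction with
  | mem ξ hξ =>
    obtain ⟨k, rfl⟩ := Submonoid.mem_closure_singleton.1 hξ
    exact add_star_mem_span_sqrt_five_of_pow_eq_one (by rw [pow_right_comm, hζ, one_pow])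
  | zero => rw [star_zero, add_zero]; exact zero_mem _
  | add z z' _ _ hz hz' => rw [star_add, add_add_add_comm]; exact add_mem hz hz'
  | smul m z _ hz => rw [star_zsmul, ← smul_add]; exact zsmul_mem hz m

theorem exists_eq_add_mul_sqrt_five {ζ : ℂ} (hζ : ζ ^ 5 = 1) {z : ℂ}
    (hz : z ∈ Algebra.adjoin ℤ {ζ}) (star_eq : star z = z) :
    ∃ r t : ℚ, z = r + t * (Real.sqrt 5 : ℂ) := by
  obtain ⟨r, t, h⟩ := Submodule.mem_span_pair.1 (add_star_mem_span_sqrt_five hζ hz)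
  rw [star_eq, Rat.smul_def, Rat.smul_def] at h
  refine ⟨r / 2, t / 2, ?_⟩
  push_cast
  linear_combination -h / 2

theorem exists_int_eq_of_isIntegral_ratCast {r : ℚ} (hr : IsIntegral ℤ (r : ℂ)) :
    ∃ m : ℤ, (r : ℂ) = m := by
  have isIntegral_rat : IsIntegral ℤ r :=
    (isIntegral_algebraMap_iff (algebraMap ℚ ℂ).injective).1 hr
  obtain ⟨m, rfl⟩ := IsIntegrallyClosed.isIntegral_iff.1 isIntegral_rat
  exact ⟨m, by simp⟩

namespace DrinfeldDouble

variable {G : Type u} [Group G] [Fintype G]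

theorem isIntegral_fsIndicator (n : ℕ) [NeZero n] (V : Type u) [AddCommGroup V] [Module ℂ V]
    [Module (DrinfeldDouble G) V] [IsScalarTower ℂ (DrinfeldDouble G) V] [FiniteDimensional ℂ V] :
    IsIntegral ℤ (fsIndicator G n V) := by
  have hζ := Complex.isPrimitiveRoot_exp n (NeZero.ne n)
  exact IsIntegral.of_mem_of_fg _ (hζ.isIntegral (NeZero.pos n)).fg_adjoin_singleton _
    (fsIndicator_mem_adjoin n hζ V)

theorem exists_fsIndicator_five_eq (V : Type u) [AddCommGroup V] [Module ℂ V]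
    [Module (DrinfeldDouble G) V] [IsScalarTower ℂ (DrinfeldDouble G) V] [FiniteDimensional ℂ V] :
    ∃ r t : ℚ, fsIndicator G 5 V = r + t * (Real.sqrt 5 : ℂ) := by
  have hζ := Complex.isPrimitiveRoot_exp 5 (by decide)
  exact exists_eq_add_mul_sqrt_five hζ.pow_eq_one (fsIndicator_mem_adjoin 5 hζ V)
    (star_fsIndicator 5 V)

end DrinfeldDouble

/-- The carry of the sum of two residues modulo 5: the cocycle of the extension
`ℤ/5 → ℤ/25 → ℤ/5`. -/
def carry (s t : ZMod 5) : ZMod 5 := if s.val + t.val < 5 then 0 else 1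

theorem carry_cocycle (r s t : ZMod 5) :
    carry r s + carry (r + s) t = carry s t + carry r (s + t) := by
  revert r s t; decide

theorem carry_zero_left (t : ZMod 5) : carry 0 t = 0 := by revert t; decide

theorem carry_zero_right (t : ZMod 5) : carry t 0 = 0 := by revert t; decide

theorem carry_sum_five (t : ZMod 5) :
    2 * carry t t + carry (t + t) (t + t) + carry (t + t + (t + t)) t = t := by
  revert t; decide

/-- The binomial coefficient `t.choose 2` modulo 5. -/
def choose₂ (t : ZMod 5) : ZMod 5 := 3 * t * (t - 1)

/-- The binomial coefficient `t.choose 3` modulo 5. -/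
def choose₃ (t : ZMod 5) : ZMod 5 := t * (t - 1) * (t - 2)

/-- The binomial coefficient `t.choose 4` modulo 5. -/
def choose₄ (t : ZMod 5) : ZMod 5 := -(t * (t - 1) * (t - 2) * (t - 3))

/-- The normal subgroup `⟨s₁, …, s₅⟩` of `M(a, b, x, y, w)`, on the normal forms
`s₁^{c₁} ⋯ s₅^{c₅}`. -/
@[ext]
structure PcCore (b x y w : ZMod 5) where
  c1 : ZMod 5
  c2 : ZMod 5
  c3 : ZMod 5
  c4 : ZMod 5
  c5 : ZMod 5

namespace PcCore

variable {b x y w : ZMod 5}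

/-- The normal form of the product of two normal forms, as found by collection. -/
protected def mul (m n : PcCore b x y w) : PcCore b x y w where
  c1 := m.c1 + n.c1
  c2 := m.c2 + n.c2
  c3 := m.c3 + n.c3
  c4 := m.c4 + n.c4 + x * n.c1 * m.c2
  c5 := m.c5 + n.c5 + y * n.c1 * m.c2 + w * x * m.c2 * choose₂ n.c1 + (x + w) * n.c1 * m.c3 +
    w * n.c1 * m.c4 - w * m.c3 * n.c2 + b * carry m.c1 n.c1

instance : Mul (PcCore b x y w) := ⟨PcCore.mul⟩

instance : One (PcCore b x y w) := ⟨⟨0, 0, 0, 0, 0⟩⟩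

theorem one_def : (1 : PcCore b x y w) = ⟨0, 0, 0, 0, 0⟩ := rfl

theorem mul_def (m n : PcCore b x y w) : m * n = PcCore.mul m n := rfl

instance : Monoid (PcCore b x y w) where
  mul_assoc m n p := by
    have cocycle := carry_cocycle m.c1 n.c1 p.c1
    ext <;> simp only [mul_def, PcCore.mul, choose₂]
    · ring
    · ring
    · ring
    · ring
    · rw [← sub_eq_zero]
      trans b * ((carry m.c1 n.c1 + carry (m.c1 + n.c1) p.c1) -
        (carry n.c1 p.c1 + carry m.c1 (n.c1 + p.c1)))
      · ring_nf
        reduce_mod_char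
      · rw [cocycle, sub_self, mul_zero]
  one_mul m := by ext <;> simp [mul_def, PcCore.mul, one_def, carry_zero_left]
  mul_one m := by ext <;> simp [mul_def, PcCore.mul, one_def, carry_zero_right, choose₂]

/-- The subgroup of the powers of `s₅`. -/
def central (b x y w : ZMod 5) : Multiplicative (ZMod 5) →* PcCore b x y w where
  toFun t := ⟨0, 0, 0, 0, t.toAdd⟩
  map_one' := rfl
  map_mul' _ _ := by ext <;> simp [mul_def, PcCore.mul, carry_zero_left]

theorem central_apply (t : Multiplicative (ZMod 5)) :
    central b x y w t = ⟨0, 0, 0, 0, t.toAdd⟩ := rfl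

theorem central_mul (t : Multiplicative (ZMod 5)) (m : PcCore b x y w) :
    central b x y w t * m = ⟨m.c1, m.c2, m.c3, m.c4, m.c5 + t.toAdd⟩ := by
  ext <;> simp [mul_def, PcCore.mul, central_apply, carry_zero_left, add_comm]

theorem mul_central (m : PcCore b x y w) (t : Multiplicative (ZMod 5)) :
    m * central b x y w t = ⟨m.c1, m.c2, m.c3, m.c4, m.c5 + t.toAdd⟩ := by
  ext <;> simp [mul_def, PcCore.mul, central_apply, carry_zero_right, choose₂]

theorem commute_central (t : Multiplicative (ZMod 5)) (m : PcCore b x y w) :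
    Commute (central b x y w t) m :=
  (central_mul t m).trans (mul_central m t).symm

/-- The normal form of the conjugate `s₀⁻ᵏ m s₀ᵏ`. It comes from collecting
`(s₁^{s₀ᵏ})^{c₁} ⋯ (s₅^{s₀ᵏ})^{c₅}`, where `s₁^{s₀ᵏ} = s₁ s₂^{C(k,1)} s₃^{C(k,2)} ⋯` up to the
corrections in `w` and `x`. -/
def conj (k : ZMod 5) (m : PcCore b x y w) : PcCore b x y w where
  c1 := m.c1
  c2 := m.c2 + k * m.c1
  c3 := m.c3 + k * m.c2 + choose₂ k * m.c1
  c4 := m.c4 + k * m.c3 + choose₂ k * m.c2 + choose₃ k * m.c1 + x * k * choose₂ m.c1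
  c5 := m.c5 + k * m.c4 + choose₂ k * m.c3 + choose₃ k * m.c2 + choose₄ k * m.c1 +
    y * k * choose₂ m.c1 + x * choose₂ k * choose₂ m.c1 + x * w * k * choose₃ m.c1 -
    w * (choose₃ k * m.c1 ^ 2 + choose₂ k * choose₂ m.c1 + choose₂ k * m.c1 * m.c2 +
      k * choose₂ m.c2)

theorem conj_mul (k : ZMod 5) (m n : PcCore b x y w) : conj k (m * n) = conj k m * conj k n := by
  ext <;> simp only [mul_def, PcCore.mul, conj, choose₂, choose₃, choose₄] <;>
    rw [← sub_eq_zero] <;> ring_nf <;> reduce_mod_char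

theorem conj_zero (m : PcCore b x y w) : conj 0 m = m := by
  ext <;> simp [conj, choose₂, choose₃, choose₄]

theorem conj_conj (k l : ZMod 5) (m : PcCore b x y w) : conj l (conj k m) = conj (k + l) m := by
  ext <;> simp only [conj, choose₂, choose₃, choose₄] <;> rw [← sub_eq_zero] <;> ring_nf <;>
    reduce_mod_char

theorem conj_one (k : ZMod 5) : conj k (1 : PcCore b x y w) = 1 := by
  ext <;> simp [conj, one_def, choose₂, choose₃]

theorem conj_central (k : ZMod 5) (t : Multiplicative (ZMod 5)) :
    conj k (central b x y w t) = central b x y w t := by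
  ext <;> simp [conj, central_apply, choose₂, choose₃]

end PcCore

/-- The group `M(a, b, x, y, w)` on the normal forms `s₀^{c₀} s₁^{c₁} ⋯ s₅^{c₅}`: the extension of
`ℤ/5` by `PcCore` in which `s₀` acts by `PcCore.conj 1` and `s₀⁵ = s₅ᵃ`. -/
@[ext]
structure PcGroup (a b x y w : ZMod 5) where
  c0 : ZMod 5
  core : PcCore b x y w

namespace PcGroup

open Multiplicative (ofAdd)

variable {a b x y w : ZMod 5}

instance : Mul (PcGroup a b x y w) where
  mul g h := ⟨g.c0 + h.c0, PcCore.conj h.c0 g.core * h.core *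
    PcCore.central b x y w (ofAdd (a * carry g.c0 h.c0))⟩

instance : One (PcGroup a b x y w) := ⟨⟨0, 1⟩⟩

theorem one_def : (1 : PcGroup a b x y w) = ⟨0, 1⟩ := rfl

theorem mul_def (g h : PcGroup a b x y w) : g * h = ⟨g.c0 + h.c0,
    PcCore.conj h.c0 g.core * h.core * PcCore.central b x y w (ofAdd (a * carry g.c0 h.c0))⟩ := rfl

instance : Monoid (PcGroup a b x y w) where
  mul_assoc g h k := by
    ext1
    · exact add_assoc _ _ _
    · simp only [mul_def, PcCore.conj_mul, PcCore.conj_conj, PcCore.conj_central, mul_assoc]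
      rw [(PcCore.commute_central _ k.core).left_comm, ← map_mul (PcCore.central b x y w),
        ← map_mul (PcCore.central b x y w), ← ofAdd_add, ← ofAdd_add, ← mul_add, ← mul_add,
        carry_cocycle]
  one_mul g := by
    simp only [mul_def, one_def, PcCore.conj_one, carry_zero_left, mul_zero, ofAdd_zero, map_one,
      one_mul, mul_one, zero_add]
  mul_one g := by
    simp only [mul_def, one_def, PcCore.conj_zero, carry_zero_right, mul_zero, ofAdd_zero, map_one,
      mul_one, add_zero]

/-- The exponent of `s₅` in the fifth power of an element with `c₀ = i` and `c₁ = j`. -/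
def fifthPower (a b w i j : ZMod 5) : ZMod 5 := a * i + b * j + i ^ 4 * j + 3 * w * i ^ 3 * j ^ 2

/-- The subgroup of the powers of `s₅`. -/
def central (a b x y w : ZMod 5) : Multiplicative (ZMod 5) →* PcGroup a b x y w where
  toFun t := ⟨0, PcCore.central b x y w t⟩
  map_one' := rfl
  map_mul' s t := by
    ext1
    · rfl
    · simp only [mul_def, PcCore.conj_central, carry_zero_left, mul_zero, ofAdd_zero, map_one,
        mul_one, map_mul]

theorem central_apply (t : Multiplicative (ZMod 5)) :
    central a b x y w t = ⟨0, PcCore.central b x y w t⟩ := rfl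

theorem central_mul (t : Multiplicative (ZMod 5)) (g : PcGroup a b x y w) :
    central a b x y w t * g = g * central a b x y w t := by
  ext1
  · exact add_comm _ _
  · simp only [mul_def, central_apply, PcCore.conj_central, PcCore.conj_zero, carry_zero_left,
      carry_zero_right, (PcCore.commute_central t g.core).eq]

theorem central_injective : Function.Injective (central a b x y w) := fun _ _ h =>
  congrArg (fun g => g.core.c5) h

theorem pow_five (g : PcGroup a b x y w) :
    g ^ 5 = central a b x y w (ofAdd (fifthPower a b w g.c0 g.core.c1)) := by
  obtain ⟨k, ⟨i1, i2, i3, i4, i5⟩⟩ := g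
  have pow_five_eq (g : PcGroup a b x y w) : g ^ 5 = (g * g) * (g * g) * g := by
    simp only [pow_succ, pow_zero, one_mul, mul_assoc]
  have carry_k := carry_sum_five k
  have carry_i1 := carry_sum_five i1
  rw [pow_five_eq]
  simp only [mul_def, PcCore.mul_central, toAdd_ofAdd]
  ext <;> simp only [PcCore.mul_def, PcCore.mul, PcCore.conj, central_apply,
    PcCore.central_apply, fifthPower, choose₂, choose₃, choose₄, toAdd_ofAdd]
  · ring_nf; reduce_mod_char
  · ring_nf; reduce_mod_char
  · ring_nf; reduce_mod_char
  · ring_nf; reduce_mod_char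
  · ring_nf; reduce_mod_char
  · generalize carry k k = K₁ at *
    generalize carry (k + k) (k + k) = K₂ at *
    generalize carry (k + k + (k + k)) k = K₃ at *
    generalize carry i1 i1 = I₁ at *
    generalize carry (i1 + i1) (i1 + i1) = I₂ at *
    generalize carry (i1 + i1 + (i1 + i1)) i1 = I₃ at *
    rw [← sub_eq_zero]
    trans a * (2 * K₁ + K₂ + K₃ - k) + b * (2 * I₁ + I₂ + I₃ - i1)
    · rw [← sub_eq_zero]
      ring_nf
      reduce_mod_char
    · rw [carry_k, carry_i1, sub_self, sub_self, mul_zero, mul_zero, add_zero]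

section FifthPower

/-- The number of `(i, j)` at which `fifthPower` takes the value `t`, as well as at
`(k + i, l + j)`. -/
def pairCount (a b w k l t : ZMod 5) : ℕ :=
  (Finset.univ.filter fun p : ZMod 5 × ZMod 5 =>
    fifthPower a b w p.1 p.2 = t ∧ fifthPower a b w (k + p.1) (l + p.2) = t).card

theorem exists_pairCount_ne (a b w : ZMod 5) (h : w ≠ 0 ∨ (b ≠ 0 ∧ ¬ (a = 0 ∧ b = -1))) :
    ∃ k l t : ZMod 5, t ≠ 0 ∧ pairCount a b w k l 1 ≠ pairCount a b w k l t := by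
  revert a b w
  decide +kernel

theorem exists_fifthPower_ne_add (a b w : ZMod 5) :
    ∃ j, fifthPower a b w 1 j ≠ fifthPower a b w 1 0 + fifthPower a b w 0 j := by
  by_cases hw : 1 + 3 * w = 0
  · refine ⟨-1, fun h => absurd (?_ : (2 : ZMod 5) = 0) (by decide)⟩
    simp only [fifthPower] at h
    linear_combination hw - h
  · refine ⟨1, fun h => hw ?_⟩
    simp only [fifthPower] at h
    linear_combination h

end FifthPower

theorem pow_twentyfive (g : PcGroup a b x y w) : g ^ 25 = 1 := by
  rw [show 25 = 5 * 5 from rfl, pow_mul, pow_five g, pow_five]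
  ext <;> simp [central_apply, PcCore.central_apply, fifthPower, one_def, PcCore.one_def]

instance : Group (PcGroup a b x y w) where
  inv g := g ^ 24
  inv_mul_cancel g := by
    change g ^ 24 * g = 1
    rw [← pow_succ, pow_twentyfive]

/-- The coordinates of a normal form; the first two determine the fifth power. -/
def coordEquiv : PcGroup a b x y w ≃
    (ZMod 5 × ZMod 5) × (ZMod 5 × ZMod 5 × ZMod 5 × ZMod 5) where
  toFun g := ((g.c0, g.core.c1), (g.core.c2, g.core.c3, g.core.c4, g.core.c5))
  invFun p := ⟨p.1.1, ⟨p.1.2, p.2.1, p.2.2.1, p.2.2.2.1, p.2.2.2.2⟩⟩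

instance : Fintype (PcGroup a b x y w) := Fintype.ofEquiv _ coordEquiv.symm

theorem natCard_eq : Nat.card (PcGroup a b x y w) = 5 ^ 6 := by
  rw [Nat.card_congr coordEquiv]
  simp

theorem isPGroup : IsPGroup 5 (PcGroup a b x y w) := IsPGroup.of_card natCard_eq

theorem exponent_eq : Monoid.exponent (PcGroup a b x y w) = 25 := by
  refine Nat.eq_prime_pow_of_dvd_least_prime_pow Nat.prime_five (k := 1) (fun h => ?_)
    (Monoid.exponent_dvd_of_forall_pow_eq_one pow_twentyfive)
  have fifthPower_eq_zero (i j : ZMod 5) : fifthPower a b w i j = 0 := by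
    have h := Monoid.exponent_dvd_iff_forall_pow_eq_one.1 h
      (⟨i, ⟨j, 0, 0, 0, 0⟩⟩ : PcGroup a b x y w)
    rw [pow_one, pow_five] at h
    exact congrArg (fun g => g.core.c5) h
  obtain ⟨j, hj⟩ := exists_fifthPower_ne_add a b w
  exact hj (by simp only [fifthPower_eq_zero, add_zero])

theorem mul_core_c1 (g h : PcGroup a b x y w) : (g * h).core.c1 = g.core.c1 + h.core.c1 := by
  rw [mul_def, PcCore.mul_central]
  rfl

/-- The homomorphism onto `(ℤ/5)²` with kernel `⟨s₂, …, s₅⟩`. -/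
def toProd : PcGroup a b x y w →* Multiplicative (ZMod 5 × ZMod 5) where
  toFun g := ofAdd (g.c0, g.core.c1)
  map_one' := rfl
  map_mul' g h := congrArg ofAdd (Prod.ext rfl (mul_core_c1 g h))

theorem pow_five_of_mem_commutator {c : PcGroup a b x y w} (hc : c ∈ commutator _) :
    c ^ 5 = 1 := by
  have toProd_eq_one : toProd c = 1 := Abelianization.commutator_subset_ker toProd hc
  obtain ⟨c0_eq, c1_eq⟩ := Prod.mk.inj (ofAdd.injective toProd_eq_one)
  rw [pow_five, c0_eq, c1_eq]
  simp [fifthPower]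

theorem not_isRegularPGroup : ¬ IsRegularPGroup 5 (PcGroup a b x y w) := by
  rintro ⟨-, regular⟩
  obtain ⟨j, hj⟩ := exists_fifthPower_ne_add a b w
  obtain ⟨L, hL, pow_eq⟩ := regular ⟨1, ⟨0, 0, 0, 0, 0⟩⟩ ⟨0, ⟨j, 0, 0, 0, 0⟩⟩ 1
  have prod_eq_one : (L.map fun c => c ^ 5 ^ 1).prod = 1 := by
    refine List.prod_eq_one fun d hd => ?_
    obtain ⟨c, hc, rfl⟩ := List.mem_map.1 hd
    exact pow_five_of_mem_commutator (Subgroup.commutator_mono le_top le_top (hL c hc))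
  rw [prod_eq_one, mul_one, pow_one, pow_five, pow_five, pow_five, mul_core_c1, ← map_mul,
    ← ofAdd_add] at pow_eq
  refine hj ?_
  simpa only [mul_def, add_zero, zero_add] using ofAdd.injective (central_injective pow_eq)

theorem powPairCount_central (k l t : ZMod 5) :
    DrinfeldDouble.powPairCount 5 (⟨k, ⟨l, 0, 0, 0, 0⟩⟩ : PcGroup a b x y w)
      (central a b x y w (ofAdd t)) = pairCount a b w k l t * 5 ^ 4 := by
  classical
  have card_eq : Fintype.card (ZMod 5 × ZMod 5 × ZMod 5 × ZMod 5) = 5 ^ 4 := by simp [ZMod.card]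
  rw [DrinfeldDouble.powPairCount, pairCount, ← card_eq, ← Finset.card_univ,
    ← Finset.card_product]
  refine Finset.card_equiv coordEquiv fun g => ?_
  simp only [Finset.mem_filter, Finset.mem_univ, true_and, pow_five, central_injective.eq_iff,
    Finset.mem_product, and_true, ofAdd.injective.eq_iff, mul_core_c1]
  rfl

theorem not_isFSZn (h : w ≠ 0 ∨ (b ≠ 0 ∧ ¬ (a = 0 ∧ b = -1))) :
    ¬ IsFSZn 5 (PcGroup a b x y w) := by
  intro hG
  have : Fact (Nat.Prime 5) := ⟨Nat.prime_five⟩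
  obtain ⟨k, l, t, ht, ne⟩ := exists_pairCount_ne a b w h
  have powPairCount_eq := hG.powPairCount_eq central_mul ⟨k, ⟨l, 0, 0, 0, 0⟩⟩
    (s := ofAdd 1) (t := ofAdd t) (ofAdd.injective.ne one_ne_zero) ht
  rw [powPairCount_central, powPairCount_central] at powPairCount_eq
  exact ne (Nat.eq_of_mul_eq_mul_right (by norm_num) powPairCount_eq)

/-- The normal form `s_kᵗ`. -/
def genPow (a b x y w : ZMod 5) (k : Fin 6) (t : ZMod 5) : PcGroup a b x y w :=
  match k with
  | 0 => ⟨t, 1⟩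
  | 1 => ⟨0, ⟨t, 0, 0, 0, 0⟩⟩
  | 2 => ⟨0, ⟨0, t, 0, 0, 0⟩⟩
  | 3 => ⟨0, ⟨0, 0, t, 0, 0⟩⟩
  | 4 => ⟨0, ⟨0, 0, 0, t, 0⟩⟩
  | 5 => ⟨0, ⟨0, 0, 0, 0, t⟩⟩

/-- The generators `s₀, …, s₅`. -/
def gens (a b x y w : ZMod 5) (k : Fin 6) : PcGroup a b x y w := genPow a b x y w k 1

theorem genPow_natCast_succ (k : Fin 6) {n : ℕ} (hn : n < 4) :
    genPow a b x y w k (n + 1 : ℕ) = genPow a b x y w k n * gens a b x y w k := by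
  have carry_eq_zero : carry n 1 = 0 := by interval_cases n <;> rfl
  fin_cases k <;> simp only [genPow, gens, mul_def, PcCore.mul_central] <;>
    ext <;> simp [PcCore.mul_def, PcCore.mul, PcCore.conj, PcCore.one_def, carry_eq_zero,
      carry_zero_left, choose₂, choose₃, choose₄]

theorem gens_pow (k : Fin 6) {n : ℕ} (hn : n < 5) :
    gens a b x y w k ^ n = genPow a b x y w k n := by
  induction n with
  | zero => rw [pow_zero, Nat.cast_zero]; fin_cases k <;> rfl
  | succ n ih => rw [pow_succ, ih (by omega), genPow_natCast_succ k (by omega)]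

theorem genPow_one_pow_val (k : Fin 6) (t : ZMod 5) :
    genPow a b x y w k 1 ^ t.val = genPow a b x y w k t := by
  rw [← gens, gens_pow k (ZMod.val_lt t), ZMod.natCast_zmod_val]

theorem normalForm (g : PcGroup a b x y w) :
    genPow a b x y w 0 g.c0 * (genPow a b x y w 1 g.core.c1 * (genPow a b x y w 2 g.core.c2 *
      (genPow a b x y w 3 g.core.c3 * (genPow a b x y w 4 g.core.c4 *
        genPow a b x y w 5 g.core.c5)))) = g := by
  simp only [genPow, mul_def, PcCore.mul_central]
  ext <;> simp [PcCore.mul_def, PcCore.mul, PcCore.conj, PcCore.one_def,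
      carry_zero_left, carry_zero_right, choose₂, choose₃, choose₄]

theorem closure_range_gens : Subgroup.closure (Set.range (gens a b x y w)) = ⊤ := by
  have genPow_mem (k : Fin 6) (t : ZMod 5) :
      genPow a b x y w k t ∈ Subgroup.closure (Set.range (gens a b x y w)) := by
    rw [← genPow_one_pow_val]
    exact pow_mem (Subgroup.subset_closure (Set.mem_range_self k)) _
  refine eq_top_iff.2 fun g _ => normalForm g ▸ ?_
  refine mul_mem (genPow_mem _ _) (mul_mem (genPow_mem _ _) (mul_mem (genPow_mem _ _)
    (mul_mem (genPow_mem _ _) (mul_mem (genPow_mem _ _) (genPow_mem _ _)))))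

theorem gens_pow_five (k : Fin 6) :
    gens a b x y w k ^ 5 = genPow a b x y w 5 (if k = 0 then a else if k = 1 then b else 0) := by
  rw [pow_five]
  fin_cases k <;> ext <;>
    simp [gens, genPow, fifthPower, central_apply, PcCore.central_apply, PcCore.one_def]

theorem isPcPresented_gens : IsPcPresented a b x y w (gens a b x y w) := by
  refine
    { gen := closure_range_gens
      pow0 := (gens_pow_five 0).trans (genPow_one_pow_val 5 a).symm
      pow1 := (gens_pow_five 1).trans (genPow_one_pow_val 5 b).symm
      pow2 := gens_pow_five 2
      pow3 := gens_pow_five 3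
      pow4 := gens_pow_five 4
      pow5 := gens_pow_five 5
      rel5 := fun k => central_mul (ofAdd 1) (gens a b x y w k)
      rel10 := ?_
      rel20 := ?_
      rel30 := ?_
      rel40 := ?_
      rel21 := ?_
      rel31 := ?_
      rel41 := ?_
      rel32 := ?_
      rel42 := ?_
      rel43 := ?_ } <;>
    simp only [gens, genPow_one_pow_val] <;>
    simp only [genPow, mul_def, PcCore.mul_central] <;>
    ext <;>
    simp [PcCore.mul_def, PcCore.mul, PcCore.conj, PcCore.one_def,
      carry_zero_left, carry_zero_right, choose₂, choose₃, choose₄]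

end PcGroup

theorem exists_natCard_eq_and_not_isFSZn_five (m : ℕ) [NeZero m] :
    ∃ (G : Type) (_ : Group G) (_ : Fintype G), Nat.card G = 5 ^ 6 * m ∧ ¬ IsFSZn 5 G := by
  refine ⟨PcGroup 0 0 0 0 1 × Multiplicative (ZMod m), inferInstance, inferInstance, ?_,
    fun h => PcGroup.not_isFSZn (.inl (by decide : (1 : ZMod 5) ≠ 0)) h.of_prod⟩
  rw [Nat.card_prod, PcGroup.natCard_eq, Nat.card_congr Multiplicative.toAdd, Nat.card_zmod]

theorem infinite_natCard_not_isFSZn_five :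
    {N : ℕ | ∃ (G : Type) (_ : Group G) (_ : Fintype G),
      Nat.card G = N ∧ ¬ IsFSZn 5 G}.Infinite :=
  Set.infinite_of_injective_forall_mem (f := fun m => 5 ^ 6 * (m + 1))
    (fun m n h => by simpa using h) fun m => exists_natCard_eq_and_not_isFSZn_five (m + 1)

theorem mainTheorem12_general :
    (∀ a b x y w : ZMod 5, ∃ (G : Type) (_ : Group G) (_ : Fintype G),
      Nat.card G = 5 ^ 6 ∧ (∃ s : Fin 6 → G, IsPcPresented a b x y w s) ∧
      Monoid.exponent G = 25 ∧ IsIrregularPGroup 5 G ∧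
      ((w ≠ 0 ∨ (b ≠ 0 ∧ ¬ (a = 0 ∧ b = -1))) → ¬ IsFSZn 5 G)) ∧
    (∀ (G : Type u) [Group G] [Fintype G]
      (V : Type u) [AddCommGroup V] [Module ℂ V] [Module (DrinfeldDouble G) V]
        [IsScalarTower ℂ (DrinfeldDouble G) V] [FiniteDimensional ℂ V],
      IsIntegral ℤ (fsIndicator G 5 V) ∧
      (∃ r t : ℚ, fsIndicator G 5 V = r + t * (Real.sqrt 5 : ℂ)) ∧
      ∀ r : ℚ, fsIndicator G 5 V = r → ∃ m : ℤ, fsIndicator G 5 V = m) ∧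
    (∀ (n : ℕ) (F H : Type u) [Group F] [Fintype F] [Group H] [Fintype H],
      IsFSZn n (F × H) → IsFSZn n F) ∧
    {N : ℕ | ∃ (G : Type) (_ : Group G) (_ : Fintype G),
      Nat.card G = N ∧ ¬ IsFSZn 5 G}.Infinite := by
  refine ⟨fun a b x y w => ?_, fun G _ _ V _ _ _ _ _ => ?_,
    fun n F H _ _ _ _ => IsFSZn.of_prod, infinite_natCard_not_isFSZn_five⟩
  · exact ⟨PcGroup a b x y w, inferInstance, inferInstance, PcGroup.natCard_eq,
      ⟨_, PcGroup.isPcPresented_gens⟩, PcGroup.exponent_eq,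
      ⟨PcGroup.isPGroup, PcGroup.not_isRegularPGroup⟩, PcGroup.not_isFSZn⟩
  · have integral := DrinfeldDouble.isIntegral_fsIndicator (G := G) 5 V
    refine ⟨integral, DrinfeldDouble.exists_fsIndicator_five_eq V, fun r hr => ?_⟩
    rw [hr] at integral ⊢
    exact exists_int_eq_of_isIntegral_ratCast integral

theorem mainTheorem12 :
    -- irregular groups of order `5 ^ 6` and exponent `25` with a non-integral `ν_5`
    (∀ a b x y w : ZMod 5, (w ≠ 0 ∨ (b ≠ 0 ∧ ¬ (a = 0 ∧ b = -1))) →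
      ∃ (G : Type) (_ : Group G) (_ : Fintype G),
        Nat.card G = 5 ^ 6 ∧ (∃ s : Fin 6 → G, IsPcPresented a b x y w s) ∧
        Monoid.exponent G = 25 ∧ IsIrregularPGroup 5 G ∧ ¬ IsFSZn 5 G) ∧
    -- the non-integral `ν_5` are algebraic integers in `ℚ(√5) \ ℚ`
    (∀ (G : Type) [Group G] [Fintype G], Nat.card G = 5 ^ 6 → Monoid.exponent G = 25 →
      ∀ (V : Type) [AddCommGroup V] [Module ℂ V] [Module (DrinfeldDouble G) V]
        [IsScalarTower ℂ (DrinfeldDouble G) V] [FiniteDimensional ℂ V]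
        [IsSimpleModule (DrinfeldDouble G) V],
        (¬ ∃ m : ℤ, fsIndicator G 5 V = m) →
          IsIntegral ℤ (fsIndicator G 5 V) ∧
          (∃ r t : ℚ, fsIndicator G 5 V = r + t * (Real.sqrt 5 : ℂ)) ∧
          ¬ ∃ r : ℚ, fsIndicator G 5 V = r) ∧
    -- a direct product with a non-`FSZ` factor is not `FSZ`
    (∀ (F H : Type) [Group F] [Fintype F] [Group H] [Fintype H],
      ¬ IsFSZ F → ¬ IsFSZ (F × H)) ∧
    -- there are non-`FSZ` groups of infinitely many orders
    {N : ℕ | ∃ (G : Type) (_ : Group G) (_ : Fintype G), Nat.card G = N ∧ ¬ IsFSZ G}.Infinite := by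
  obtain ⟨groups, indicators, of_prod, infinite⟩ := mainTheorem12_general.{0}
  refine ⟨fun a b x y w h => ?_, fun G _ _ _ _ V _ _ _ _ _ _ not_int => ?_,
    fun F H _ _ _ _ hF hFH => hF fun n hn => of_prod n F H (hFH n hn),
    infinite.mono ?_⟩
  · obtain ⟨G, _, _, card_eq, presented, exponent_eq, irregular, not_isFSZn⟩ := groups a b x y w
    exact ⟨G, _, _, card_eq, presented, exponent_eq, irregular, not_isFSZn h⟩
  · obtain ⟨integral, mem_field, int_of_rat⟩ := indicators G V
    exact ⟨integral, mem_field, fun ⟨r, hr⟩ => not_int (int_of_rat r hr)⟩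
  · rintro N ⟨G, _, _, card_eq, not_isFSZn⟩
    exact ⟨G, _, _, card_eq, fun hG => not_isFSZn (hG 5 (by norm_num))⟩
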